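/- Let $B=\begin{bmatrix}0&1\\-1&0\end{bmatrix}$. For $a\in[\pi/2,\pi)$ and complex-valued functions $q,p\in L_2(0,\pi)$ vanishing a.e. on $(0,a)$, put $Q(x)=\begin{bmatrix}q(x)&p(x)\\p(x)&-q(x)\end{bmatrix}$ and, for $j=1,2$, let ${\cal B}_{1,j}(Q)$ be the boundary value problem $$By'(x)+Q(x)y(x-a)=\lambda y(x),\quad 0<x<\pi,\qquad y_1(0)=y_j(\pi)=0,$$ for absolutely continuous $y=(y_1,y_2)^T$. Its spectrum is the sequence $\{\lambda_{n,j}\}_{n\in\mathbb Z}$ of the zeros, counted with multiplicity, of its characteristic function $\Delta_j(\lambda)=y_j(\pi,\lambda)$, an entire function of $\lambda$, where $y(x,\lambda)$ is the solution of the equation with $y(0,\lambda)=(0,1)^T$. Then for every $r>0$ there is $C_r>0$, depending only on $r$, such that the following holds. Let $a\in[\pi/2,\pi)$, let $(q,p)$ and $(\tilde q,\tilde p)$ be two pairs of functions as above, let $Q$ and $\tilde Q$ be the corresponding matrices, and let $\{\lambda_{n,j}\}_{n\in\mathbb Z}$ and $\{\tilde\lambda_{n,j}\}_{n\in\mathbb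 Z}$ be the spectra of ${\cal B}_{1,j}(Q)$ and ${\cal B}_{1,j}(\tilde Q)$, numbered so that for $j=1,2$ $$\Big\|\Big\{\lambda_{n,j}-n-\frac{1-j}2\Big\}_{n\in\mathbb Z}\Big\|_{l_2}\le r,\qquad \Big\|\Big\{\tilde\lambda_{n,j}-n-\frac{1-j}2\Big\}_{n\in\mathbb Z}\Big\|_{l_2}\le r.$$ Then $$\|q-\tilde q\|_{L_2(a,\pi)}+\|p-\tilde p\|_{L_2(a,\pi)}\le C_r\Big(\|\{\lambda_{n,1}-\tilde\lambda_{n,1}\}_{n\in\mathbb Z}\|_{l_2}+\|\{\lambda_{n,2}-\tilde\lambda_{n,2}\}_{n\in\mathbb Z}\|_{l_2}\Big).$$ -/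

import Mathlib

open MeasureTheory

noncomputable section

namespace DiracDelay

/-- The matrix `B` of the Dirac-type system. -/
def B : Matrix (Fin 2) (Fin 2) ℂ := !![0, 1; -1, 0]

/-- The potential matrix `Q` with `q₁₁ = -q₂₂ = q` and `q₁₂ = q₂₁ = p`. -/
def potential (q p : ℝ → ℂ) (x : ℝ) : Matrix (Fin 2) (Fin 2) ℂ := !![q x, p x; p x, -q x]

/-- An admissible coefficient: a complex-valued function in `L₂(0, π)` vanishing (almost everywhere)
on `(0, a)`. -/
structure IsAdmissible (a : ℝ) (f : ℝ → ℂ) : Prop where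
  memLp : MemLp f 2 (volume.restrict (Set.Ioo 0 Real.pi))
  eq_zero : ∀ᵐ x ∂volume.restrict (Set.Ioo 0 a), f x = 0

/-- `y` is an absolutely continuous solution on `[0, π]` of the system with delay
`B y'(x) + Q(x) y(x - a) = z y(x)` for almost every `x ∈ (0, π)`. As `Q` vanishes on `(0, a)`, the
values of `y` at negative arguments are irrelevant. -/
structure IsSolution (a : ℝ) (Q : ℝ → Matrix (Fin 2) (Fin 2) ℂ) (z : ℂ) (y : ℝ → Fin 2 → ℂ) :
    Prop where
  absolutelyContinuous : AbsolutelyContinuousOnInterval y 0 Real.pi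
  equation : ∀ᵐ x ∂volume.restrict (Set.Ioo 0 Real.pi), ∃ y' : Fin 2 → ℂ,
    HasDerivAt y y' x ∧ B.mulVec y' + (Q x).mulVec (y (x - a)) = z • y x

/-- `D` is the characteristic function of the boundary value problem for the above system with
the conditions `y₁(0) = y_j(π) = 0`: for each `z`, `D z` is the `j`-th component at `π` of the
solution with the initial value `y(0) = (0, 1)`, i.e. of the second column of the
fundamental matrix-solution `Y(x, z)`, `Y(0, z) = I`. Components are numbered by `0, 1`
instead of `1, 2`. -/
def IsCharFun (a : ℝ) (Q : ℝ → Matrix (Fin 2) (Fin 2) ℂ) (j : Fin 2) (D : ℂ → ℂ) : Prop :=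
  ∀ z : ℂ, ∃ y : ℝ → Fin 2 → ℂ, IsSolution a Q z y ∧ y 0 = ![0, 1] ∧ D z = y Real.pi j

/-- The sequence `lam`, indexed by the integers, is the spectrum of the boundary value problem with
the conditions `y₁(0) = y_j(π) = 0`: each complex number occurs in `lam` as many times as its
multiplicity as a zero of the (entire) characteristic function. -/
def IsSpectrum (a : ℝ) (Q : ℝ → Matrix (Fin 2) (Fin 2) ℂ) (j : Fin 2) (lam : ℤ → ℂ) : Prop :=
  ∃ D : ℂ → ℂ, IsCharFun a Q j D ∧ ∀ z : ℂ, {n : ℤ | lam n = z}.encard = analyticOrderAt D z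

/-- The `l₂` norm of a sequence indexed by the integers, with value `∞` when it is not in `l₂`. -/
def l2Norm (x : ℤ → ℂ) : ENNReal := eLpNorm x 2 Measure.count

/-- The norm in `L₂(a, π)`, with values in `[0, ∞]`. -/
def L2Norm (a : ℝ) (f : ℝ → ℂ) : ENNReal := eLpNorm f 2 (volume.restrict (Set.Ioo a Real.pi))

end DiracDelay

end

namespace DiracDelay

open Filter Topology Complex

/-! Since `a ≥ π/2`, every delayed argument `x - a` with `x ≤ π` lies in the region where the
potential vanishes and the solution is free. One integration therefore solves the system exactly,
and the characteristic functions are affine in `(q, p)`. After a sign change for `j = 1` and a shift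
of the spectral parameter by `1/2` for `j = 2`, both have the form `F(z) = sin πz + ∫_a^π ψ(t)
e^{iz(π+a-2t)} dt` (`IsSolution.gauge_pi`, `IsCharFun.sin_add_zero`, `IsCharFun.sin_add_one`).

The integral has exponential type at most `π/2`, smaller than the type `π` of the sine. This forces
the zeros `μ n` to determine the values at integers: `F(k) = π cos(πk) (k - μ k) ∏_{n ≠ k} (k - μ
n)/(k - n)` (`tendsto_prod_zeros`). No canonical factorization is needed. The finite quotients `K N
= F ∏(z - n) / (sin πz ∏(z - μ n))` are bounded on growing squares by the maximum principle and tend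
to `1` at `i√N`; a Schwarz estimate carries this limit to `k`.

The product formula is Lipschitz in the zeros, as a map into `l₂` over `k`, with constants involving
only `r` (`sum_norm_value_sub_sq_le`). On an interval inside `(0, π)` the exponentials at integer
`z` are Fourier characters, so Parseval turns the `l₂` bound into an `L₂` bound for the difference
of densities (`exists_density_stability`). The norm of `ψ` enters only the qualitative limit, never
the final constant. Finally, `q` and `p` are recovered from the two densities by elementary linear
algebra (`eLpNorm_sub_le_density`). -/

/-! ### Dividing out finitely many zeros -/

/-- The hypothesis counts indices, so repeated values of `μ` are divided out with multiplicity. Each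
induction step removes one linear factor by `dslope`, which lowers the order by one at `μ m` and
nowhere else. -/
theorem exists_entire_factor (S : Finset ℤ) (μ : ℤ → ℂ) {F : ℂ → ℂ} (hF : Differentiable ℂ F)
    (h : ∀ z, ((S.filter fun n => μ n = z).card : ℕ∞) ≤ analyticOrderAt F z) :
    ∃ A : ℂ → ℂ, Differentiable ℂ A ∧ ∀ z, F z = (∏ n ∈ S, (z - μ n)) * A z := by
  induction S using Finset.induction_on generalizing F with
  | empty => exact ⟨F, hF, by simp⟩
  | insert m S hm ih =>
    have hFm : F (μ m) = 0 := by
      have h1 := h (μ m)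
      have h2 : 1 ≤ ((insert m S).filter fun n => μ n = μ m).card :=
        Finset.card_pos.2 ⟨m, by simp⟩
      have h3 : analyticOrderAt F (μ m) ≠ 0 := by
        intro h0
        rw [h0] at h1
        have : ((insert m S).filter fun n => μ n = μ m).card = 0 := by
          simp at h1
        omega
      by_contra h4
      exact h3 ((hF.analyticAt _).analyticOrderAt_eq_zero.2 h4)
    set G := dslope F (μ m)
    have hG : Differentiable ℂ G := by
      rw [← differentiableOn_univ]
      exact (Complex.differentiableOn_dslope Filter.univ_mem).2 hF.differentiableOn
    have hFG : ∀ z, F z = (z - μ m) * G z := by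
      intro z
      have := sub_smul_dslope F (μ m) z
      rw [hFm, sub_zero, smul_eq_mul] at this
      exact this.symm
    obtain ⟨A, hA, hGA⟩ := ih hG (by
      intro z
      have h1 := h z
      have h2 : analyticOrderAt F z = analyticOrderAt (fun w => w - μ m) z + analyticOrderAt G z := by
        rw [← analyticOrderAt_mul (by fun_prop) (hG.analyticAt z)]
        congr 1
        funext w
        exact hFG w
      rw [h2, Finset.filter_insert] at h1
      by_cases hz : μ m = z
      · rw [if_pos hz, Finset.card_insert_of_notMem (by simp [hm])] at h1
        have h3 : analyticOrderAt (fun w => w - μ m) z = 1 := by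
          rw [← hz]
          have : AnalyticAt ℂ (fun w => w - μ m) (μ m) := by fun_prop
          exact_mod_cast (this.analyticOrderAt_eq_natCast (n := 1)).2
            ⟨fun _ => 1, by fun_prop, by simp, by simp⟩
        rw [h3, add_comm] at h1
        push_cast at h1
        exact (ENat.add_le_add_iff_left (by simp)).1 h1
      · rw [if_neg hz] at h1
        have h3 : analyticOrderAt (fun w => w - μ m) z = 0 := by
          have : AnalyticAt ℂ (fun w => w - μ m) z := by fun_prop
          exact this.analyticOrderAt_eq_zero.2 (sub_ne_zero.2 (Ne.symm hz))
        rwa [h3, zero_add] at h1)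
    refine ⟨A, hA, fun z => ?_⟩
    rw [hFG, hGA, Finset.prod_insert hm, mul_assoc]

theorem hasDerivAt_sin_pi_mul (z : ℂ) :
    HasDerivAt (fun w : ℂ => sin (Real.pi * w)) (Real.pi * cos (Real.pi * z)) z := by
  have h : HasDerivAt (fun w : ℂ => (Real.pi : ℂ) * w) (Real.pi : ℂ) z := by
    simpa using (hasDerivAt_id z).const_mul (Real.pi : ℂ)
  have := (Complex.hasDerivAt_sin (Real.pi * z)).comp z h
  rwa [mul_comm] at this

theorem cos_pi_mul_intCast_ne_zero (k : ℤ) : cos (Real.pi * (k : ℂ)) ≠ 0 := by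
  intro h
  have := sin_sq_add_cos_sq (Real.pi * (k : ℂ))
  rw [h, mul_comm (Real.pi : ℂ), sin_int_mul_pi] at this
  norm_num at this

/-- Differentiating the factorization at `k ∈ S` gives the value of the cofactor there. It is
nonzero because the zeros of the sine are simple, so the cofactor vanishes only at integers outside
`S`. -/
theorem exists_sin_factor (S : Finset ℤ) :
    ∃ A : ℂ → ℂ, Differentiable ℂ A ∧
      (∀ z, sin (Real.pi * z) = (∏ n ∈ S, (z - (n : ℂ))) * A z) ∧
      (∀ k ∈ S, (Real.pi : ℂ) * cos (Real.pi * k) = (∏ n ∈ S.erase k, ((k : ℂ) - n)) * A k) ∧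
      ∀ z : ℂ, (∀ n : ℤ, n ∉ S → z ≠ n) → A z ≠ 0 := by
  have hd : Differentiable ℂ fun w : ℂ => sin (Real.pi * w) :=
    fun z => (hasDerivAt_sin_pi_mul z).differentiableAt
  obtain ⟨A, hA, h⟩ := exists_entire_factor S (fun n => (n : ℂ)) hd (by
    intro z
    by_cases hz : ∃ m : ℤ, (m : ℂ) = z
    · obtain ⟨m, rfl⟩ := hz
      have h1 : (S.filter fun n : ℤ => (n : ℂ) = m).card ≤ 1 := by
        rw [Finset.card_le_one]
        intro a ha b hb
        simp only [Finset.mem_filter, Int.cast_inj] at ha hb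
        rw [ha.2, hb.2]
      have h2 : analyticOrderAt (fun w : ℂ => sin (Real.pi * w)) m ≠ 0 := by
        intro h0
        refine (hd.analyticAt _).analyticOrderAt_eq_zero.1 h0 ?_
        rw [mul_comm, sin_int_mul_pi]
      calc _ ≤ ((1 : ℕ) : ℕ∞) := by exact_mod_cast h1
        _ ≤ _ := by simpa using Order.one_le_iff_ne_zero.2 h2
    · rw [Finset.filter_false_of_mem (fun n _ hn => hz ⟨n, hn⟩)]
      simp)
  have hder : ∀ k ∈ S,
      (Real.pi : ℂ) * cos (Real.pi * k) = (∏ n ∈ S.erase k, ((k : ℂ) - n)) * A k := by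
    intro k hk
    have h1 : HasDerivAt (fun z : ℂ => (z - k) * ((∏ n ∈ S.erase k, (z - (n : ℂ))) * A z))
        ((∏ n ∈ S.erase k, ((k : ℂ) - n)) * A k) k := by
      have h2 : DifferentiableAt ℂ (fun z : ℂ => (∏ n ∈ S.erase k, (z - (n : ℂ))) * A z) k := by
        refine DifferentiableAt.mul ?_ (hA _)
        fun_prop
      have h3 := ((hasDerivAt_id (k : ℂ)).sub_const (k : ℂ)).mul h2.hasDerivAt
      simp only [id, sub_self, zero_mul, one_mul, add_zero] at h3
      exact h3
    refine (hasDerivAt_sin_pi_mul k).unique (h1.congr_of_eventuallyEq (Eventually.of_forall ?_))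
    intro z
    simp only [h z]
    rw [← mul_assoc, Finset.mul_prod_erase S (fun n : ℤ => z - (n : ℂ)) hk]
  refine ⟨A, hA, h, hder, fun z hz hA0 => ?_⟩
  have h0 : sin (Real.pi * z) = 0 := by rw [h, hA0, mul_zero]
  obtain ⟨k, hk⟩ := Complex.sin_eq_zero_iff.1 h0
  have hzk : z = k := by
    have : (Real.pi : ℂ) ≠ 0 := by exact_mod_cast Real.pi_ne_zero
    apply mul_left_cancel₀ this
    rw [hk, mul_comm]
  have hkS : k ∈ S := by
    by_contra hkS
    exact hz k hkS hzk
  have := hder k hkS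
  rw [← hzk, hA0, mul_zero, hzk] at this
  exact mul_ne_zero (by exact_mod_cast Real.pi_ne_zero) (cos_pi_mul_intCast_ne_zero k) this

/-- A finite interpolation of `F` by a polynomial multiple of the sine function. -/
theorem exists_quotient {F : ℂ → ℂ} (hF : Differentiable ℂ F) (μ : ℤ → ℂ)
    (h : ∀ (S : Finset ℤ) (z : ℂ), ((S.filter fun n => μ n = z).card : ℕ∞) ≤ analyticOrderAt F z)
    (N : ℕ) :
    ∃ K : ℂ → ℂ, DifferentiableOn ℂ K {z | |z.re| < N + 1} ∧
      (∀ z : ℂ, |z.re| < N + 1 →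
        F z * ∏ n ∈ Finset.Icc (-N : ℤ) N, (z - (n : ℂ)) =
          sin (Real.pi * z) * (∏ n ∈ Finset.Icc (-N : ℤ) N, (z - μ n)) * K z) ∧
      ∀ k ∈ Finset.Icc (-N : ℤ) N, F k = Real.pi * cos (Real.pi * k) * (k - μ k) *
        (∏ n ∈ (Finset.Icc (-N : ℤ) N).erase k, (k - μ n) / ((k : ℂ) - n)) * K k := by
  set S := Finset.Icc (-N : ℤ) N
  obtain ⟨A, hA, hFA⟩ := exists_entire_factor S μ hF (h S)
  obtain ⟨B, hB, hsB, hdB, hB0⟩ := exists_sin_factor S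
  have hB0' : ∀ z : ℂ, |z.re| < N + 1 → B z ≠ 0 := by
    intro z hz
    refine hB0 z fun n hn hzn => hn ?_
    rw [hzn, intCast_re, abs_lt] at hz
    have h1 : -(N + 1 : ℤ) < n := by exact_mod_cast hz.1
    have h2 : n < (N + 1 : ℤ) := by exact_mod_cast hz.2
    simp only [S, Finset.mem_Icc]
    omega
  refine ⟨fun z => A z / B z, fun z hz => ?_, fun z hz => ?_, fun k hk => ?_⟩
  · exact ((hA z).div (hB z) (hB0' z hz)).differentiableWithinAt
  · have := hB0' z hz
    rw [hFA, hsB]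
    field_simp
  · have hk' : B k ≠ 0 := by
      apply hB0'
      simp only [S, Finset.mem_Icc] at hk
      rw [intCast_re, abs_lt]
      constructor
      · have : -(N + 1 : ℤ) < k := by omega
        exact_mod_cast this
      · have : k < (N + 1 : ℤ) := by omega
        exact_mod_cast this
    have h1 : ∏ n ∈ S.erase k, ((k : ℂ) - n) ≠ 0 := by
      refine Finset.prod_ne_zero_iff.2 fun n hn => sub_ne_zero.2 ?_
      exact_mod_cast (Finset.ne_of_mem_erase hn).symm
    rw [hFA, hdB k hk, Finset.prod_div_distrib, ← Finset.mul_prod_erase S _ hk]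
    field_simp

/-! ### Lower bounds for the sine and for finite products -/

theorem summable_one_div_int_add_half_sq :
    Summable fun n : ℤ => 1 / ((n : ℝ) + 1 / 2) ^ 2 := by
  have := (Real.summable_one_div_int_add_rpow (1 / 2) 2).2 (by norm_num)
  refine this.congr fun n => ?_
  rw [Real.rpow_two, sq_abs]

theorem norm_sin_eq_of_cos_re_eq_zero {w : ℂ} (h : Real.cos w.re = 0) :
    ‖sin w‖ = Real.cosh w.im := by
  have h1 : Real.sin w.re ^ 2 = 1 := by
    have := Real.sin_sq_add_cos_sq w.re
    rw [h] at this
    linarith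
  have h2 : |Real.sin w.re| = 1 := by
    rw [← sq_abs] at h1
    nlinarith [abs_nonneg (Real.sin w.re)]
  rw [Complex.sin_eq, ← ofReal_cos, h, ← ofReal_sin, ← ofReal_cosh]
  simp only [ofReal_zero, zero_mul, add_zero, norm_mul, norm_real, Real.norm_eq_abs, h2, one_mul,
    abs_of_pos (Real.cosh_pos _)]

theorem exp_abs_le_four_mul_norm_sin_of_cos_re_eq_zero {w : ℂ} (h : Real.cos w.re = 0) :
    Real.exp |w.im| ≤ 4 * ‖sin w‖ := by
  rw [norm_sin_eq_of_cos_re_eq_zero h, ← Real.cosh_abs, Real.cosh_eq]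
  have := Real.exp_pos |w.im|
  have := Real.exp_pos (-|w.im|)
  linarith

theorem exp_abs_le_four_mul_norm_sin_of_one_le {w : ℂ} (h : 1 ≤ |w.im|) :
    Real.exp |w.im| ≤ 4 * ‖sin w‖ := by
  have h1 : ‖sin w‖ = ‖exp (-w * I) - exp (w * I)‖ / 2 := by
    rw [Complex.sin]
    simp
  have h2 : |Real.exp w.im - Real.exp (-w.im)| ≤ ‖exp (-w * I) - exp (w * I)‖ := by
    have := abs_norm_sub_norm_le (exp (-w * I)) (exp (w * I))
    rw [norm_exp, norm_exp] at this
    simpa using this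
  have h3 : Real.exp |w.im| - Real.exp (-|w.im|) ≤ |Real.exp w.im - Real.exp (-w.im)| := by
    rcases abs_cases w.im with h | h
    · rw [h.1]
      exact le_abs_self _
    · rw [h.1, neg_neg, abs_sub_comm]
      exact le_abs_self _
  have h4 : 2 ≤ Real.exp |w.im| := by
    have := Real.add_one_le_exp |w.im|
    linarith
  have h5 : Real.exp (-|w.im|) ≤ 1 := Real.exp_le_one_iff.2 (by linarith)
  linarith

/-- Factorwise this is `1 - t ≥ e^{-2t}` on `[0, 1/2]`, which follows from `e^{2t} ≥ 1 + 2t` and `(1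
+ 2t)(1 - t) ≥ 1`. -/
theorem exp_neg_le_prod_norm_one_sub {ι : Type*} (S : Finset ι) (x : ι → ℂ)
    (h : ∀ i ∈ S, ‖x i‖ ≤ 1 / 2) :
    Real.exp (-(2 * ∑ i ∈ S, ‖x i‖)) ≤ ‖∏ i ∈ S, (1 - x i)‖ := by
  rw [norm_prod, Finset.mul_sum, ← Finset.sum_neg_distrib, Real.exp_sum]
  refine Finset.prod_le_prod (fun _ _ => (Real.exp_pos _).le) fun i hi => ?_
  have h1 : 1 - ‖x i‖ ≤ ‖1 - x i‖ := by
    simpa using norm_sub_norm_le (1 : ℂ) (x i)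
  refine le_trans ?_ h1
  have h2 := h i hi
  have h3 := norm_nonneg (x i)
  rw [Real.exp_neg, inv_le_comm₀ (Real.exp_pos _) (by linarith)]
  have h4 := Real.add_one_le_exp (2 * ‖x i‖)
  refine le_trans ?_ h4
  rw [inv_le_iff_one_le_mul₀ (by linarith)]
  nlinarith

/-- The algebraic relation between `F`, the sine function and a finite quotient, in divided form. -/
theorem div_sin_eq_prod_mul {F : ℂ → ℂ} {μ : ℤ → ℂ} {S : Finset ℤ} {K z : ℂ}
    (hs : sin (Real.pi * z) ≠ 0)
    (h : F z * ∏ n ∈ S, (z - (n : ℂ)) = sin (Real.pi * z) * (∏ n ∈ S, (z - μ n)) * K) :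
    F z / sin (Real.pi * z) = (∏ n ∈ S, (1 - (μ n - n) / (z - n))) * K := by
  have hz : ∀ n : ℤ, z - n ≠ 0 := by
    intro n h0
    apply hs
    rw [sub_eq_zero.1 h0, mul_comm, sin_int_mul_pi]
  have h1 : ∏ n ∈ S, (1 - (μ n - n) / (z - n)) = (∏ n ∈ S, (z - μ n)) / ∏ n ∈ S, (z - (n : ℂ)) := by
    rw [← Finset.prod_div_distrib]
    refine Finset.prod_congr rfl fun n _ => ?_
    have := hz n
    field_simp
    ring
  have h2 : ∏ n ∈ S, (z - (n : ℂ)) ≠ 0 := Finset.prod_ne_zero_iff.2 fun n _ => hz n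
  rw [h1]
  field_simp
  linear_combination h

/-- Where the sine has its full size, `F / sin` is at most `1 + 4M`, and the product of the `1 - (μ
n - n)/(z - n)` is at least `e^{-2σ}`; the quotient `K` is their ratio. -/
theorem norm_quotient_le {F : ℂ → ℂ} {μ : ℤ → ℂ} {S : Finset ℤ} {K z : ℂ} {M σ : ℝ}
    (hs : Real.exp |(Real.pi * z).im| ≤ 4 * ‖sin (Real.pi * z)‖) (hM : 0 ≤ M)
    (hF : ‖F z - sin (Real.pi * z)‖ ≤ M * Real.exp (Real.pi / 2 * |z.im|))
    (h : F z * ∏ n ∈ S, (z - (n : ℂ)) = sin (Real.pi * z) * (∏ n ∈ S, (z - μ n)) * K)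
    (hx : ∀ n ∈ S, ‖(μ n - n) / (z - n)‖ ≤ 1 / 2)
    (hσ : ∑ n ∈ S, ‖(μ n - n) / (z - n)‖ ≤ σ) :
    ‖K‖ ≤ (1 + 4 * M) * Real.exp (2 * σ) := by
  have hs0 : 0 < ‖sin (Real.pi * z)‖ := by
    have := Real.exp_pos |(Real.pi * z).im|
    linarith
  have h1 := div_sin_eq_prod_mul (norm_pos_iff.1 hs0) h
  have h2 : ‖F z / sin (Real.pi * z)‖ ≤ 1 + 4 * M := by
    rw [norm_div, div_le_iff₀ hs0]
    have h3 : Real.exp (Real.pi / 2 * |z.im|) ≤ Real.exp |(Real.pi * z).im| := by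
      apply Real.exp_le_exp.2
      rw [im_ofReal_mul, abs_mul, abs_of_pos Real.pi_pos]
      gcongr
      linarith [Real.pi_pos]
    have h4 : ‖F z‖ ≤ ‖sin (Real.pi * z)‖ + ‖F z - sin (Real.pi * z)‖ := norm_le_norm_add_norm_sub' _ _
    have h5 : M * Real.exp (Real.pi / 2 * |z.im|) ≤ M * (4 * ‖sin (Real.pi * z)‖) := by
      gcongr
      exact h3.trans hs
    linarith
  have h3 := exp_neg_le_prod_norm_one_sub S _ hx
  have h4 : Real.exp (-(2 * σ)) ≤ ‖∏ n ∈ S, (1 - (μ n - n) / (z - n))‖ :=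
    le_trans (Real.exp_le_exp.2 (by linarith)) h3
  rw [h1, norm_mul] at h2
  have h5 : Real.exp (-(2 * σ)) * ‖K‖ ≤ 1 + 4 * M :=
    le_trans (mul_le_mul_of_nonneg_right h4 (norm_nonneg _)) h2
  calc ‖K‖ = Real.exp (-(2 * σ)) * ‖K‖ * Real.exp (2 * σ) := by
        rw [mul_right_comm, ← Real.exp_add]; simp
    _ ≤ _ := by gcongr

theorem div_le_sq_add_one_div_sq {x y w : ℝ} (hx : 0 ≤ x) (hy : 0 < y) (hw : y ≤ w) :
    x / w ≤ x ^ 2 + 1 / y ^ 2 := by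
  have h1 : x / w ≤ x / y := by gcongr
  have h2 : x / y = x * (1 / y) := by ring
  have h3 : 1 / y ^ 2 = (1 / y) ^ 2 := by ring
  rw [h3]
  nlinarith [sq_nonneg (x - 1 / y), sq_nonneg (x + 1 / y)]

/-! ### Uniform bound for the quotients on growing squares -/

section Bounds

variable {F : ℂ → ℂ} {μ : ℤ → ℂ} {M : ℝ}

theorem exists_norm_quotient_le (hM : 0 ≤ M)
    (hFM : ∀ z, ‖F z - sin (Real.pi * z)‖ ≤ M * Real.exp (Real.pi / 2 * |z.im|))
    (hμ : Summable fun n : ℤ => ‖μ n - n‖ ^ 2) (K : ℕ → ℂ → ℂ)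
    (hK : ∀ N, DifferentiableOn ℂ (K N) {z | |z.re| < N + 1})
    (hFK : ∀ (N : ℕ) (z : ℂ), |z.re| < N + 1 → F z * ∏ n ∈ Finset.Icc (-N : ℤ) N, (z - (n : ℂ)) =
      sin (Real.pi * z) * (∏ n ∈ Finset.Icc (-N : ℤ) N, (z - μ n)) * K N z) :
    ∃ C : ℝ, ∀ᶠ N : ℕ in atTop, ∀ z : ℂ, |z.re| ≤ N → |z.im| ≤ N → ‖K N z‖ ≤ C := by
  set E := ∑' n : ℤ, ‖μ n - n‖ ^ 2 with hE
  set c := ∑' n : ℤ, 1 / ((n : ℝ) + 1 / 2) ^ 2 with hc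
  have hE0 : 0 ≤ E := tsum_nonneg fun _ => by positivity
  have hc0 : 0 ≤ c := tsum_nonneg fun _ => by positivity
  have hεE : ∀ n : ℤ, ‖μ n - n‖ ≤ 1 + E := by
    intro n
    have : ‖μ n - n‖ ^ 2 ≤ E := hμ.le_tsum n fun _ _ => by positivity
    nlinarith [sq_nonneg (‖μ n - n‖ - 1)]
  -- On the vertical sides the distance to an integer can be as small as `1/2`, so `1/4` is what
  -- keeps the ratio below `1/2`. The finitely many other indices are handled by taking `N` large.
  obtain ⟨n0, hn0⟩ : ∃ n0 : ℕ, ∀ n : ℤ, (n0 : ℤ) < |n| → ‖μ n - n‖ ≤ 1 / 4 := by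
    have h1 : ∀ᶠ n : ℤ in cofinite, ‖μ n - n‖ ^ 2 < 1 / 16 :=
      hμ.tendsto_cofinite_zero.eventually_lt_const (by norm_num)
    rw [eventually_cofinite] at h1
    obtain ⟨b, hb⟩ := (h1.image fun n : ℤ => |n|).bddAbove
    refine ⟨b.toNat, fun n hn => ?_⟩
    by_contra h2
    have h3 : |n| ≤ b := hb ⟨n, by simp only [Set.mem_ofPred_eq]; nlinarith, rfl⟩
    have := Int.self_le_toNat b
    omega
  -- The vertical sides contribute `E + c` to the exponent and the horizontal ones `2 * (1 + E)`;
  -- the sum of the two serves for both.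
  refine ⟨(1 + 4 * M) * Real.exp (2 * (E + c + 2 * (1 + E))), ?_⟩
  filter_upwards [eventually_ge_atTop (n0 + ⌈2 * (1 + E)⌉₊ + 1)] with N hN
  have hNR : (n0 : ℝ) + 2 * (1 + E) + 1 ≤ N := by
    have h1 : ((n0 + ⌈2 * (1 + E)⌉₊ + 1 : ℕ) : ℝ) ≤ N := by exact_mod_cast hN
    push_cast at h1
    linarith [Nat.le_ceil (2 * (1 + E))]
  have hn00 : (0 : ℝ) ≤ n0 := n0.cast_nonneg
  -- Half-integer sides pass midway between zeros of the sine, where `|sin πz| = cosh(π Im z)`, and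
  -- stay inside the strip on which `K N` is holomorphic.
  set R : ℝ := N + 1 / 2 with hR
  have hR0 : 0 < R := by positivity
  have hU : Bornology.IsBounded (Set.Ioo (-R) R ×ℂ Set.Ioo (-R) R) :=
    (Metric.isBounded_Ioo _ _).reProdIm (Metric.isBounded_Ioo _ _)
  have hcl : closure (Set.Ioo (-R) R ×ℂ Set.Ioo (-R) R) = Set.Icc (-R) R ×ℂ Set.Icc (-R) R := by
    rw [closure_reProdIm, closure_Ioo (by linarith)]
  have hd : DiffContOnCl ℂ (K N) (Set.Ioo (-R) R ×ℂ Set.Ioo (-R) R) := by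
    apply DifferentiableOn.diffContOnCl
    rw [hcl]
    refine (hK N).mono fun z hz => ?_
    have : |z.re| ≤ R := abs_le.2 (mem_reProdIm.1 hz).1
    simp only [Set.mem_ofPred_eq]
    linarith
  have hfr : ∀ z ∈ frontier (Set.Ioo (-R) R ×ℂ Set.Ioo (-R) R),
      ‖K N z‖ ≤ (1 + 4 * M) * Real.exp (2 * (E + c + 2 * (1 + E))) := by
    intro z hz
    rw [frontier_reProdIm, frontier_Ioo (by linarith), closure_Ioo (by linarith)] at hz
    have hzre : |z.re| < N + 1 := by
      rcases hz with hz | hz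
      · have : |z.re| ≤ R := abs_le.2 (mem_reProdIm.1 hz).1
        linarith
      · have h1 := (mem_reProdIm.1 hz).1
        simp only [Set.mem_insert_iff, Set.mem_singleton_iff] at h1
        rw [abs_lt]
        rcases h1 with h1 | h1 <;> rw [h1] <;> constructor <;> linarith
    rcases hz with hz | hz
    · have h1 := (mem_reProdIm.1 hz).2
      have him : |z.im| = R := by
        simp only [Set.mem_insert_iff, Set.mem_singleton_iff] at h1
        rcases h1 with h1 | h1 <;> rw [h1]
        · rw [abs_neg, abs_of_pos hR0]
        · rw [abs_of_pos hR0]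
      have hzn : ∀ n : ℤ, R ≤ ‖z - n‖ := by
        intro n
        have := abs_im_le_norm (z - n)
        simpa [him] using this
      have hx : ∀ n : ℤ, ‖(μ n - n) / (z - n)‖ ≤ (1 + E) / R := by
        intro n
        rw [norm_div]
        exact div_le_div₀ (by linarith) (hεE n) hR0 (hzn n)
      refine norm_quotient_le ?_ hM (hFM z) (hFK N z hzre) (fun n _ => (hx n).trans ?_) ?_
      · apply exp_abs_le_four_mul_norm_sin_of_one_le
        rw [im_ofReal_mul, abs_mul, him, abs_of_pos Real.pi_pos]
        nlinarith [Real.pi_gt_three]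
      · rw [div_le_iff₀ hR0]
        linarith
      -- There are `2N + 1 = 2R` terms, each at most `(1 + E)/R`, so the sum does not grow with `N`.
      · calc ∑ n ∈ Finset.Icc (-N : ℤ) N, ‖(μ n - n) / (z - n)‖
            ≤ ∑ n ∈ Finset.Icc (-N : ℤ) N, (1 + E) / R := Finset.sum_le_sum fun n _ => hx n
          _ = 2 * (1 + E) := by
              rw [Finset.sum_const, Int.card_Icc, nsmul_eq_mul]
              have : (((N : ℤ) + 1 - -N).toNat : ℝ) = 2 * R := by
                have : ((N : ℤ) + 1 - -N).toNat = 2 * N + 1 := by omega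
                rw [this, hR]
                push_cast
                ring
              rw [this]
              field_simp
          _ ≤ _ := by linarith
    · have h1 := (mem_reProdIm.1 hz).1
      obtain ⟨m, hm, hmN⟩ : ∃ m : ℤ, z.re = m + 1 / 2 ∧ (m = N ∨ m = -N - 1) := by
        simp only [Set.mem_insert_iff, Set.mem_singleton_iff] at h1
        rcases h1 with h1 | h1
        · refine ⟨-N - 1, ?_, Or.inr rfl⟩
          rw [h1, hR]
          push_cast
          ring
        · exact ⟨N, by rw [h1, hR]; push_cast; ring, Or.inl rfl⟩
      have hzn : ∀ n : ℤ, |((m - n : ℤ) : ℝ) + 1 / 2| ≤ ‖z - n‖ := by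
        intro n
        have := abs_re_le_norm (z - n)
        rw [sub_re, intCast_re, hm] at this
        convert this using 2
        push_cast
        ring
      have hhalf : ∀ l : ℤ, 1 / 2 ≤ |(l : ℝ) + 1 / 2| := by
        intro l
        rcases le_or_gt 0 l with hl | hl
        · have : (0 : ℝ) ≤ l := by exact_mod_cast hl
          rw [abs_of_pos (by linarith)]
          linarith
        · have : (l : ℝ) ≤ -1 := by exact_mod_cast Int.le_sub_one_of_lt hl
          rw [abs_of_neg (by linarith)]
          linarith
      have hcos : Real.cos (Real.pi * z).re = 0 := by
        rw [Real.cos_eq_zero_iff]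
        refine ⟨m, ?_⟩
        rw [re_ofReal_mul, hm]
        ring
      refine norm_quotient_le (exp_abs_le_four_mul_norm_sin_of_cos_re_eq_zero hcos) hM (hFM z)
        (hFK N z hzre) (fun n _ => ?_) ?_
      · rw [norm_div, div_le_iff₀ (lt_of_lt_of_le (by linarith [hhalf (m - n)]) (hzn n))]
        by_cases hn : (n0 : ℤ) < |n|
        · linarith [hn0 n hn, hzn n, hhalf (m - n)]
        · have h2 : |(n : ℝ)| ≤ n0 := by
            exact_mod_cast not_lt.1 hn
          have h3 : (N : ℝ) + 1 / 2 ≤ |(m : ℝ) + 1 / 2| := by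
            rcases hmN with h | h <;> rw [h] <;> push_cast
            · exact le_abs_self _
            · rw [show -(N : ℝ) - 1 + 1 / 2 = -(N + 1 / 2) by ring, abs_neg]
              exact le_abs_self _
          have h4 : |(m : ℝ) + 1 / 2| - |(n : ℝ)| ≤ |((m - n : ℤ) : ℝ) + 1 / 2| := by
            rw [show ((m - n : ℤ) : ℝ) + 1 / 2 = m + 1 / 2 - n by push_cast; ring]
            exact abs_sub_abs_le_abs_sub _ _
          linarith [hεE n, hzn n]
      · calc ∑ n ∈ Finset.Icc (-N : ℤ) N, ‖(μ n - n) / (z - n)‖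
            ≤ ∑ n ∈ Finset.Icc (-N : ℤ) N,
                (‖μ n - n‖ ^ 2 + 1 / (((m - n : ℤ) : ℝ) + 1 / 2) ^ 2) := by
              refine Finset.sum_le_sum fun n _ => ?_
              rw [norm_div, ← sq_abs (((m - n : ℤ) : ℝ) + 1 / 2)]
              exact div_le_sq_add_one_div_sq (norm_nonneg _) (by linarith [hhalf (m - n)]) (hzn n)
          _ ≤ E + c := by
              rw [Finset.sum_add_distrib]
              gcongr
              · exact hμ.sum_le_tsum _ fun _ _ => by positivity
              · have h2 := (Equiv.subLeft m).summable_iff.2 summable_one_div_int_add_half_sq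
                have h3 := (Equiv.subLeft m).tsum_eq fun n : ℤ => 1 / ((n : ℝ) + 1 / 2) ^ 2
                rw [hc, ← h3]
                exact h2.sum_le_tsum _ fun _ _ => by positivity
          _ ≤ _ := by linarith
  intro z hz1 hz2
  refine Complex.norm_le_of_forall_mem_frontier_norm_le hU hd hfr ?_
  rw [hcl, mem_reProdIm]
  exact ⟨abs_le.1 (by linarith), abs_le.1 (by linarith)⟩

end Bounds

/-! ### Values at integers as limits of products over the zeros -/

section Limit

variable {F : ℂ → ℂ} {μ : ℤ → ℂ} {M : ℝ}

theorem tendsto_div_sin_imaginary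
    (hFM : ∀ z, ‖F z - sin (Real.pi * z)‖ ≤ M * Real.exp (Real.pi / 2 * |z.im|)) :
    Tendsto (fun y : ℝ => F (y * I) / sin (Real.pi * (y * I))) atTop (𝓝 1) := by
  have h1 : Tendsto (fun y : ℝ => 4 * M * Real.exp (-(Real.pi / 2 * y))) atTop (𝓝 0) := by
    have h2 : Tendsto (fun y : ℝ => Real.pi / 2 * y) atTop atTop :=
      tendsto_id.const_mul_atTop (by positivity)
    simpa using (Real.tendsto_exp_neg_atTop_nhds_zero.comp h2).const_mul (4 * M)
  refine tendsto_iff_norm_sub_tendsto_zero.2 (squeeze_zero' (Eventually.of_forall fun _ =>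
    norm_nonneg _) ?_ h1)
  filter_upwards [eventually_ge_atTop 1] with y hy
  have him : (Real.pi * (y * I)).im = Real.pi * y := by simp
  have hpy : 0 < Real.pi * y := by positivity
  have hs : Real.exp (Real.pi * y) ≤ 4 * ‖sin (Real.pi * (y * I))‖ := by
    have := exp_abs_le_four_mul_norm_sin_of_one_le (w := Real.pi * (y * I)) (by
      rw [him, abs_of_pos hpy]
      nlinarith [Real.pi_gt_three])
    rwa [him, abs_of_pos hpy] at this
  have hs0 : 0 < ‖sin (Real.pi * (y * I))‖ := by
    have := Real.exp_pos (Real.pi * y)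
    linarith
  have h2 := hFM (y * I)
  rw [show (y * I).im = y by simp, abs_of_pos (by linarith)] at h2
  rw [div_sub_one (norm_pos_iff.1 hs0), norm_div, div_le_iff₀ hs0]
  refine h2.trans ?_
  have hM : 0 ≤ M := by
    have := (norm_nonneg _).trans h2
    exact nonneg_of_mul_nonneg_left this (Real.exp_pos _)
  calc M * Real.exp (Real.pi / 2 * y)
      = M * Real.exp (-(Real.pi / 2 * y)) * Real.exp (Real.pi * y) := by
        rw [mul_assoc, ← Real.exp_add]; ring_nf
    _ ≤ M * Real.exp (-(Real.pi / 2 * y)) * (4 * ‖sin (Real.pi * (y * I))‖) := by gcongr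
    _ = _ := by ring

/-- Dominated convergence. For `y ≥ 1` one has `|iy - n| ≥ |n + 1/2|/√2`, and the half-integer shift
keeps the majorant finite at `n = 0`. -/
theorem tendsto_tsum_div_imaginary (hμ : Summable fun n : ℤ => ‖μ n - n‖ ^ 2) :
    (∀ y : ℝ, 1 ≤ y → Summable fun n : ℤ => ‖(μ n - n) / (y * I - n)‖) ∧
    Tendsto (fun y : ℝ => ∑' n : ℤ, ‖(μ n - n) / (y * I - n)‖) atTop (𝓝 0) := by
  have hb : ∀ y : ℝ, 1 ≤ y → ∀ n : ℤ, ‖(μ n - n) / (y * I - n)‖ ≤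
      ‖μ n - n‖ ^ 2 + 2 * (1 / ((n : ℝ) + 1 / 2) ^ 2) := by
    intro y hy n
    have hn : 0 < |(n : ℝ) + 1 / 2| := by
      rw [abs_pos]
      intro h0
      have : (2 * n + 1 : ℝ) = 0 := by linarith
      have h1 : (2 * n + 1 : ℤ) = 0 := by exact_mod_cast this
      omega
    have h1 : ‖y * I - n‖ ^ 2 = n ^ 2 + y ^ 2 := by
      rw [← normSq_eq_norm_sq, normSq_apply]
      simp
      ring
    have h2 : |(n : ℝ) + 1 / 2| / √2 ≤ ‖y * I - n‖ := by
      apply abs_le_of_sq_le_sq' _ (norm_nonneg _) |>.2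
      rw [h1, div_pow, Real.sq_sqrt (by norm_num), sq_abs]
      nlinarith [sq_nonneg ((n : ℝ) - 1 / 2)]
    rw [norm_div]
    have h3 := div_le_sq_add_one_div_sq (norm_nonneg (μ n - n)) (by positivity) h2
    rw [div_pow, Real.sq_sqrt (by norm_num), sq_abs, one_div_div] at h3
    refine h3.trans (le_of_eq ?_)
    ring
  have hs := hμ.add (summable_one_div_int_add_half_sq.mul_left 2)
  refine ⟨fun y hy => hs.of_nonneg_of_le (fun _ => norm_nonneg _) (hb y hy), ?_⟩
  have := tendsto_tsum_of_dominated_convergence (𝓕 := atTop)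
    (f := fun (y : ℝ) (n : ℤ) => ‖(μ n - n) / (y * I - n)‖) (g := fun _ => (0 : ℝ)) hs ?_ ?_
  · simpa using this
  · intro n
    have h1 : Tendsto (fun y : ℝ => ‖μ n - n‖ * y⁻¹) atTop (𝓝 0) := by
      simpa using tendsto_inv_atTop_zero.const_mul ‖μ n - n‖
    refine squeeze_zero' (Eventually.of_forall fun _ => norm_nonneg _) ?_ h1
    filter_upwards [eventually_gt_atTop 0] with y hy
    rw [norm_div, div_eq_mul_inv]
    gcongr
    have := abs_im_le_norm (y * I - n)
    simpa [abs_of_pos hy] using this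
  · filter_upwards [eventually_ge_atTop 1] with y hy n
    rw [norm_norm]
    exact hb y hy n

/-- The values at the integers of a sine-type function are determined by its zeros. -/
theorem tendsto_prod_zeros (hF : Differentiable ℂ F) (hM : 0 ≤ M)
    (hFM : ∀ z, ‖F z - sin (Real.pi * z)‖ ≤ M * Real.exp (Real.pi / 2 * |z.im|))
    (hμ : Summable fun n : ℤ => ‖μ n - n‖ ^ 2)
    (hord : ∀ (S : Finset ℤ) (z : ℂ),
      ((S.filter fun n => μ n = z).card : ℕ∞) ≤ analyticOrderAt F z) (k : ℤ) :
    Tendsto (fun N : ℕ => Real.pi * cos (Real.pi * k) * (k - μ k) *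
      ∏ n ∈ (Finset.Icc (-N : ℤ) N).erase k, (k - μ n) / ((k : ℂ) - n)) atTop (𝓝 (F k)) := by
  choose K hK hFK hKk using exists_quotient hF μ hord
  obtain ⟨C, hC⟩ := exists_norm_quotient_le hM hFM hμ K hK hFK
  -- The comparison point `i√N` goes to infinity, so that `F / sin` and the product tend to `1`
  -- there, yet it is `o(N)`, so that it is close to `k` on the scale of the square.
  have hsqrt : Tendsto (fun N : ℕ => √(N : ℝ)) atTop atTop :=
    Real.tendsto_sqrt_atTop.comp tendsto_natCast_atTop_atTop
  have hsqrt_le : ∀ N : ℕ, 1 ≤ N → √(N : ℝ) ≤ N := by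
    intro N hN
    have : (1 : ℝ) ≤ N := by exact_mod_cast hN
    rw [Real.sqrt_le_left (by linarith)]
    nlinarith
  have hprod : Tendsto (fun N : ℕ => ∏ n ∈ Finset.Icc (-N : ℤ) N,
      (1 - (μ n - n) / ((√(N : ℝ) : ℝ) * I - n))) atTop (𝓝 1) := by
    obtain ⟨hs, ht⟩ := tendsto_tsum_div_imaginary hμ
    have h1 : Tendsto (fun N : ℕ => Real.exp (∑' n : ℤ,
        ‖(μ n - n) / ((√(N : ℝ) : ℝ) * I - n)‖) - 1) atTop (𝓝 0) := by
      have := (Real.continuous_exp.tendsto 0).comp (ht.comp hsqrt)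
      simpa using this.sub_const 1
    refine tendsto_iff_norm_sub_tendsto_zero.2 (squeeze_zero' (Eventually.of_forall fun _ =>
      norm_nonneg _) ?_ h1)
    filter_upwards [hsqrt.eventually_ge_atTop 1] with N hN
    have h2 := Finset.norm_prod_one_add_sub_one_le (Finset.Icc (-N : ℤ) N)
      fun n => -((μ n - n) / ((√(N : ℝ) : ℝ) * I - n))
    simp only [← sub_eq_add_neg, norm_neg] at h2
    refine h2.trans ?_
    gcongr
    exact (hs _ hN).sum_le_tsum _ fun _ _ => norm_nonneg _
  have hKI : Tendsto (fun N : ℕ => K N ((√(N : ℝ) : ℝ) * I)) atTop (𝓝 1) := by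
    have h1 := ((tendsto_div_sin_imaginary hFM).comp hsqrt).div hprod one_ne_zero
    rw [div_one] at h1
    refine h1.congr' ?_
    filter_upwards [hprod.eventually_ne one_ne_zero, hsqrt.eventually_ge_atTop 1] with N hN hN1
    have hs : sin (Real.pi * ((√(N : ℝ) : ℝ) * I)) ≠ 0 := by
      have h2 := exp_abs_le_four_mul_norm_sin_of_one_le (w := Real.pi * ((√(N : ℝ) : ℝ) * I)) (by
        rw [show (Real.pi * ((√(N : ℝ) : ℝ) * I)).im = Real.pi * √(N : ℝ) by simp,
          abs_of_nonneg (by positivity)]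
        nlinarith [Real.pi_gt_three])
      rw [← norm_pos_iff]
      linarith [Real.exp_pos |(Real.pi * ((√(N : ℝ) : ℝ) * I)).im|]
    have h2 := div_sin_eq_prod_mul hs (hFK N ((√(N : ℝ) : ℝ) * I) (by
      simp only [mul_re, ofReal_re, I_re, mul_zero, ofReal_im, I_im, mul_one, sub_self, abs_zero]
      positivity))
    simp only [Function.comp, Pi.div_apply]
    rw [h2]
    exact mul_div_cancel_left₀ _ hN
  have hKk1 : Tendsto (fun N : ℕ => K N k) atTop (𝓝 1) := by
    have h1 : Tendsto (fun N : ℕ => 4 * C * (|(k : ℝ)| * (N : ℝ)⁻¹ + (√(N : ℝ))⁻¹)) atTop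
        (𝓝 0) := by
      have h2 := (tendsto_inv_atTop_zero.comp
        (tendsto_natCast_atTop_atTop (R := ℝ))).const_mul |(k : ℝ)|
      have h3 := (h2.add (tendsto_inv_atTop_zero.comp hsqrt)).const_mul (4 * C)
      simpa using h3
    have h2 : Tendsto (fun N : ℕ => K N k - K N ((√(N : ℝ) : ℝ) * I)) atTop (𝓝 0) := by
      refine squeeze_zero_norm' ?_ h1
      have hN4 : ∀ᶠ N : ℕ in atTop, 2 * |(k : ℝ)| + 1 + √(N : ℝ) * 3 ≤ N := by
        have h4 := hsqrt.eventually_ge_atTop (2 * |(k : ℝ)| + 4)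
        filter_upwards [h4] with N hN
        have h5 := Real.sq_sqrt (N.cast_nonneg (α := ℝ))
        nlinarith [abs_nonneg (k : ℝ)]
      filter_upwards [hC, hN4, eventually_ge_atTop 1] with N hN hN4 hN1
      have hN0 : (0 : ℝ) < N := by exact_mod_cast hN1
      have hs0 : 0 < √(N : ℝ) := Real.sqrt_pos.2 hN0
      have hk0 := abs_nonneg (k : ℝ)
      have hdist : dist ((√(N : ℝ) : ℝ) * I) (k : ℂ) ≤ |(k : ℝ)| + √(N : ℝ) := by
        rw [dist_eq_norm]
        refine (norm_sub_le _ _).trans ?_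
        rw [norm_mul, norm_I, norm_real, mul_one, Real.norm_of_nonneg hs0.le, norm_intCast]
        linarith
      have hbox : ∀ z ∈ Metric.ball (k : ℂ) (N / 2 : ℝ), |z.re| ≤ N ∧ |z.im| ≤ N := by
        intro z hz
        rw [Metric.mem_ball, dist_eq_norm] at hz
        have h5 : ‖z‖ ≤ N := by
          have h6 := norm_le_norm_add_norm_sub' z (k : ℂ)
          rw [norm_intCast] at h6
          linarith
        exact ⟨(abs_re_le_norm z).trans h5, (abs_im_le_norm z).trans h5⟩
      have hmem : (k : ℂ) ∈ Metric.ball (k : ℂ) (N / 2 : ℝ) :=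
        Metric.mem_ball_self (by positivity)
      -- Schwarz lemma on the disc of radius `N/2` about `k`: as `K N` is bounded by `C`, it varies
      -- by at most `2C` from its centre value, so its change up to `i√N` is `O((|k| + √N)/N)`.
      have h6 := Complex.dist_le_div_mul_dist_of_mapsTo_ball (f := K N) (c := (k : ℂ))
        (R₁ := N / 2) (R₂ := 2 * C) (z := (√(N : ℝ) : ℝ) * I)
        ((hK N).mono fun z hz => by
          have := (hbox z hz).1
          simp only [Set.mem_ofPred_eq]
          linarith)
        (fun z hz => by
          rw [Metric.mem_closedBall, dist_eq_norm]
          have h7 := hN z (hbox z hz).1 (hbox z hz).2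
          have h8 := hN k (hbox k hmem).1 (hbox k hmem).2
          exact (norm_sub_le _ _).trans (by linarith))
        (by
          rw [Metric.mem_ball]
          linarith)
      rw [dist_comm, dist_eq_norm] at h6
      refine h6.trans ?_
      have hC0 : 0 ≤ C := (norm_nonneg _).trans (hN k (hbox k hmem).1 (hbox k hmem).2)
      have h9 : √(N : ℝ) * (N : ℝ)⁻¹ = (√(N : ℝ))⁻¹ := by
        field_simp
        exact Real.sq_sqrt hN0.le
      calc 2 * C / (N / 2) * dist ((√(N : ℝ) : ℝ) * I) (k : ℂ)
          ≤ 2 * C / (N / 2) * (|(k : ℝ)| + √(N : ℝ)) := by gcongr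
        _ = 4 * C * (|(k : ℝ)| * (N : ℝ)⁻¹ + √(N : ℝ) * (N : ℝ)⁻¹) := by
            field_simp
            ring
        _ = _ := by rw [h9]
    simpa using h2.add hKI
  have h1 := (tendsto_const_nhds (x := F k)).div hKk1 one_ne_zero
  rw [div_one] at h1
  refine h1.congr' ?_
  filter_upwards [hKk1.eventually_ne one_ne_zero, eventually_ge_atTop k.natAbs] with N hN hN1
  have hk : k ∈ Finset.Icc (-N : ℤ) N := by
    rw [Finset.mem_Icc]
    omega
  simp only [Pi.div_apply]
  rw [hKk N k hk]
  exact mul_div_cancel_right₀ _ hN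

end Limit

/-! ### Lipschitz dependence of the values on the zeros -/

theorem norm_prod_le_exp_sum {ι : Type*} (S : Finset ι) (a : ι → ℂ) (α : ι → ℝ)
    (ha : ∀ i ∈ S, ‖a i‖ ≤ Real.exp (α i)) : ‖∏ i ∈ S, a i‖ ≤ Real.exp (∑ i ∈ S, α i) := by
  rw [norm_prod, Real.exp_sum]
  exact Finset.prod_le_prod (fun _ _ => norm_nonneg _) ha

theorem norm_prod_sub_prod_le {ι : Type*} [DecidableEq ι] (S : Finset ι) (a b : ι → ℂ) (α : ι → ℝ)
    (hα : ∀ i ∈ S, 0 ≤ α i) (ha : ∀ i ∈ S, ‖a i‖ ≤ Real.exp (α i))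
    (hb : ∀ i ∈ S, ‖b i‖ ≤ Real.exp (α i)) :
    ‖∏ i ∈ S, a i - ∏ i ∈ S, b i‖ ≤ Real.exp (∑ i ∈ S, α i) * ∑ i ∈ S, ‖a i - b i‖ := by
  induction S using Finset.induction_on with
  | empty => simp
  | insert m S hm ih =>
    simp only [Finset.mem_insert, forall_eq_or_imp] at hα ha hb
    rw [Finset.prod_insert hm, Finset.prod_insert hm, Finset.sum_insert hm, Finset.sum_insert hm,
      Real.exp_add]
    have h1 := ih hα.2 ha.2 hb.2
    have h2 := norm_prod_le_exp_sum S a α ha.2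
    have h3 : a m * ∏ i ∈ S, a i - b m * ∏ i ∈ S, b i =
        (a m - b m) * ∏ i ∈ S, a i + b m * (∏ i ∈ S, a i - ∏ i ∈ S, b i) := by ring
    have h4 : 1 ≤ Real.exp (α m) := Real.one_le_exp hα.1
    calc _ ≤ ‖a m - b m‖ * ‖∏ i ∈ S, a i‖ + ‖b m‖ * ‖∏ i ∈ S, a i - ∏ i ∈ S, b i‖ := by
          rw [h3, ← norm_mul, ← norm_mul]
          exact norm_add_le _ _
      _ ≤ ‖a m - b m‖ * Real.exp (∑ i ∈ S, α i) +
            Real.exp (α m) * (Real.exp (∑ i ∈ S, α i) * ∑ i ∈ S, ‖a i - b i‖) := by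
          gcongr
          exact hb.1
      _ ≤ Real.exp (α m) * (‖a m - b m‖ * Real.exp (∑ i ∈ S, α i)) +
            Real.exp (α m) * (Real.exp (∑ i ∈ S, α i) * ∑ i ∈ S, ‖a i - b i‖) := by
          exact add_le_add_left (le_mul_of_one_le_left
            (mul_nonneg (norm_nonneg _) (Real.exp_pos _).le) h4) _
      _ = _ := by ring

theorem summable_one_div_int_sq : Summable fun n : ℤ => 1 / (n : ℝ) ^ 2 :=
  Real.summable_one_div_int_pow.2 (by norm_num)

/-- Cauchy–Schwarz, uniform in `k` by translation. A term `n = k`, if present, vanishes since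
division by zero gives zero, in agreement with the zero term of `∑ 1/n²`. -/
theorem sum_div_abs_sub_le {x : ℤ → ℝ} {d : ℝ} (hd : 0 ≤ d)
    (hx : Summable fun n => x n ^ 2) (hxd : ∑' n, x n ^ 2 ≤ d ^ 2) (k : ℤ) (S : Finset ℤ) :
    ∑ n ∈ S, x n / |(k : ℝ) - n| ≤ d * √(∑' n : ℤ, 1 / (n : ℝ) ^ 2) := by
  have h1 := Real.sum_mul_le_sqrt_mul_sqrt S x fun n : ℤ => 1 / |(k : ℝ) - n|
  simp only [mul_one_div] at h1
  refine h1.trans ?_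
  gcongr
  · rw [Real.sqrt_le_left hd]
    exact (hx.sum_le_tsum _ fun _ _ => sq_nonneg _).trans hxd
  · have h2 := (Equiv.subLeft k).summable_iff.2 summable_one_div_int_sq
    have h3 := (Equiv.subLeft k).tsum_eq fun n : ℤ => 1 / (n : ℝ) ^ 2
    rw [← h3]
    refine le_trans (le_of_eq ?_) (h2.sum_le_tsum S fun _ _ => by positivity)
    refine Finset.sum_congr rfl fun n _ => ?_
    simp [sq_abs]

/-- The bound keeps `‖μ k - μ' k‖` and `‖μ' k - k‖` as separate factors because each is
square-summable in `k`; a bound uniform in `k` would not give an `l₂` estimate. -/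
theorem norm_value_sub_le {r d : ℝ} (hr : 0 ≤ r) (hd : 0 ≤ d) {μ μ' : ℤ → ℂ}
    (hμ : Summable fun n : ℤ => ‖μ n - n‖ ^ 2) (hμr : ∑' n : ℤ, ‖μ n - n‖ ^ 2 ≤ r ^ 2)
    (hμ' : Summable fun n : ℤ => ‖μ' n - n‖ ^ 2) (hμr' : ∑' n : ℤ, ‖μ' n - n‖ ^ 2 ≤ r ^ 2)
    (hδ : Summable fun n : ℤ => ‖μ n - μ' n‖ ^ 2) (hδd : ∑' n : ℤ, ‖μ n - μ' n‖ ^ 2 ≤ d ^ 2)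
    {k : ℤ} {f f' : ℂ}
    (hf : Tendsto (fun N : ℕ => Real.pi * cos (Real.pi * k) * (k - μ k) *
      ∏ n ∈ (Finset.Icc (-N : ℤ) N).erase k, (k - μ n) / ((k : ℂ) - n)) atTop (𝓝 f))
    (hf' : Tendsto (fun N : ℕ => Real.pi * cos (Real.pi * k) * (k - μ' k) *
      ∏ n ∈ (Finset.Icc (-N : ℤ) N).erase k, (k - μ' n) / ((k : ℂ) - n)) atTop (𝓝 f')) :
    ‖f - f'‖ ≤ Real.pi * Real.exp (2 * (r * √(∑' n : ℤ, 1 / (n : ℝ) ^ 2))) *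
      (‖μ k - μ' k‖ + ‖μ' k - k‖ * (d * √(∑' n : ℤ, 1 / (n : ℝ) ^ 2))) := by
  set c := √(∑' n : ℤ, 1 / (n : ℝ) ^ 2)
  refine le_of_tendsto (hf.sub hf').norm (Eventually.of_forall fun N => ?_)
  set S := (Finset.Icc (-N : ℤ) N).erase k with hS
  set E := Real.exp (2 * (r * c)) with hE
  have hkn : ∀ n ∈ S, (k : ℂ) - n ≠ 0 := fun n hn =>
    sub_ne_zero.2 (by exact_mod_cast (Finset.ne_of_mem_erase hn).symm)
  have hnorm : ∀ n : ℤ, ‖(k : ℂ) - n‖ = |(k : ℝ) - n| := by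
    intro n
    rw [← Int.cast_sub, norm_intCast, Int.cast_sub]
  have hfac : ∀ (ν : ℤ → ℂ), ∀ n ∈ S,
      ‖(k - ν n) / ((k : ℂ) - n)‖ ≤ Real.exp (‖ν n - n‖ / |(k : ℝ) - n|) := by
    intro ν n hn
    have h1 : (k - ν n) / ((k : ℂ) - n) = 1 - (ν n - n) / (k - n) := by
      field_simp [hkn n hn]
      ring
    rw [h1]
    refine (norm_sub_le _ _).trans ?_
    rw [norm_one, norm_div, hnorm, add_comm]
    exact Real.add_one_le_exp _
  -- Adding the deviations of both sequences yields one exponent dominating the factors of both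
  -- products.
  have hα : ∑ n ∈ S, (‖μ n - n‖ / |(k : ℝ) - n| + ‖μ' n - n‖ / |(k : ℝ) - n|) ≤ 2 * (r * c) := by
    rw [Finset.sum_add_distrib, two_mul]
    exact add_le_add (sum_div_abs_sub_le hr hμ hμr k S) (sum_div_abs_sub_le hr hμ' hμr' k S)
  have hfac1 : ∀ n ∈ S, ‖(k - μ n) / ((k : ℂ) - n)‖ ≤
      Real.exp (‖μ n - n‖ / |(k : ℝ) - n| + ‖μ' n - n‖ / |(k : ℝ) - n|) := fun n hn =>
    (hfac μ n hn).trans (Real.exp_le_exp.2 (le_add_of_nonneg_right (by positivity)))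
  have hfac2 : ∀ n ∈ S, ‖(k - μ' n) / ((k : ℂ) - n)‖ ≤
      Real.exp (‖μ n - n‖ / |(k : ℝ) - n| + ‖μ' n - n‖ / |(k : ℝ) - n|) := fun n hn =>
    (hfac μ' n hn).trans (Real.exp_le_exp.2 (le_add_of_nonneg_left (by positivity)))
  have hP : ‖∏ n ∈ S, (k - μ n) / ((k : ℂ) - n)‖ ≤ E :=
    (norm_prod_le_exp_sum S _ _ hfac1).trans (Real.exp_le_exp.2 hα)
  have hPP : ‖∏ n ∈ S, (k - μ n) / ((k : ℂ) - n) - ∏ n ∈ S, (k - μ' n) / ((k : ℂ) - n)‖ ≤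
      E * (d * c) := by
    refine (norm_prod_sub_prod_le S _ _ _ (fun n _ => by positivity) hfac1 hfac2).trans ?_
    refine mul_le_mul (Real.exp_le_exp.2 hα) ?_
      (Finset.sum_nonneg fun _ _ => norm_nonneg _) (Real.exp_pos _).le
    refine le_trans (le_of_eq ?_) (sum_div_abs_sub_le hd hδ hδd k S)
    refine Finset.sum_congr rfl fun n _ => ?_
    rw [← sub_div, norm_div, hnorm, sub_sub_sub_cancel_left, norm_sub_rev]
  have hcos : ‖cos (Real.pi * k)‖ ≤ 1 := by
    have : cos (Real.pi * k) = ((Real.cos (Real.pi * k) : ℝ) : ℂ) := by push_cast; rfl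
    rw [this, norm_real]
    exact Real.abs_cos_le_one _
  set P := ∏ n ∈ S, (k - μ n) / ((k : ℂ) - n)
  set P' := ∏ n ∈ S, (k - μ' n) / ((k : ℂ) - n)
  have h1 : Real.pi * cos (Real.pi * k) * (k - μ k) * P -
      Real.pi * cos (Real.pi * k) * (k - μ' k) * P' =
      Real.pi * cos (Real.pi * k) * ((μ' k - μ k) * P + (k - μ' k) * (P - P')) := by ring
  rw [h1, norm_mul, norm_mul, norm_real, Real.norm_of_nonneg Real.pi_pos.le]
  calc Real.pi * ‖cos (Real.pi * k)‖ * ‖(μ' k - μ k) * P + (k - μ' k) * (P - P')‖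
      ≤ Real.pi * 1 * (‖μ k - μ' k‖ * E + ‖μ' k - k‖ * (E * (d * c))) := by
        gcongr
        refine (norm_add_le _ _).trans ?_
        rw [norm_mul, norm_mul, norm_sub_rev (μ' k), norm_sub_rev (k : ℂ)]
        gcongr
    _ = _ := by ring

/-- Uniform Lipschitz dependence of the values at the integers on the zeros. -/
theorem sum_norm_value_sub_sq_le {r d : ℝ} (hr : 0 ≤ r) (hd : 0 ≤ d) {μ μ' : ℤ → ℂ}
    (hμ : Summable fun n : ℤ => ‖μ n - n‖ ^ 2) (hμr : ∑' n : ℤ, ‖μ n - n‖ ^ 2 ≤ r ^ 2)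
    (hμ' : Summable fun n : ℤ => ‖μ' n - n‖ ^ 2) (hμr' : ∑' n : ℤ, ‖μ' n - n‖ ^ 2 ≤ r ^ 2)
    (hδ : Summable fun n : ℤ => ‖μ n - μ' n‖ ^ 2) (hδd : ∑' n : ℤ, ‖μ n - μ' n‖ ^ 2 ≤ d ^ 2)
    {f f' : ℤ → ℂ}
    (hf : ∀ k : ℤ, Tendsto (fun N : ℕ => Real.pi * cos (Real.pi * k) * (k - μ k) *
      ∏ n ∈ (Finset.Icc (-N : ℤ) N).erase k, (k - μ n) / ((k : ℂ) - n)) atTop (𝓝 (f k)))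
    (hf' : ∀ k : ℤ, Tendsto (fun N : ℕ => Real.pi * cos (Real.pi * k) * (k - μ' k) *
      ∏ n ∈ (Finset.Icc (-N : ℤ) N).erase k, (k - μ' n) / ((k : ℂ) - n)) atTop (𝓝 (f' k)))
    (S : Finset ℤ) :
    ∑ k ∈ S, ‖f k - f' k‖ ^ 2 ≤
      2 * (Real.pi * Real.exp (2 * (r * √(∑' n : ℤ, 1 / (n : ℝ) ^ 2)))) ^ 2 *
        (1 + r ^ 2 * ∑' n : ℤ, 1 / (n : ℝ) ^ 2) * d ^ 2 := by
  set s := ∑' n : ℤ, 1 / (n : ℝ) ^ 2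
  have hs : √s ^ 2 = s := Real.sq_sqrt (tsum_nonneg fun _ => by positivity)
  set E := Real.pi * Real.exp (2 * (r * √s))
  have hE : 0 < E := by positivity
  have h1 : ∀ k, ‖f k - f' k‖ ^ 2 ≤
      2 * E ^ 2 * (‖μ k - μ' k‖ ^ 2 + ‖μ' k - k‖ ^ 2 * (d ^ 2 * s)) := by
    intro k
    have h2 := norm_value_sub_le hr hd hμ hμr hμ' hμr' hδ hδd (hf k) (hf' k)
    calc ‖f k - f' k‖ ^ 2 ≤ (E * (‖μ k - μ' k‖ + ‖μ' k - k‖ * (d * √s))) ^ 2 := by gcongr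
      _ = E ^ 2 * (‖μ k - μ' k‖ + ‖μ' k - k‖ * (d * √s)) ^ 2 := by ring
      _ ≤ E ^ 2 * (2 * (‖μ k - μ' k‖ ^ 2 + (‖μ' k - k‖ * (d * √s)) ^ 2)) := by
          gcongr
          exact add_sq_le
      _ = 2 * E ^ 2 * (‖μ k - μ' k‖ ^ 2 + ‖μ' k - k‖ ^ 2 * (d ^ 2 * √s ^ 2)) := by ring
      _ = _ := by rw [hs]
  calc ∑ k ∈ S, ‖f k - f' k‖ ^ 2
      ≤ ∑ k ∈ S, 2 * E ^ 2 * (‖μ k - μ' k‖ ^ 2 + ‖μ' k - k‖ ^ 2 * (d ^ 2 * s)) :=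
        Finset.sum_le_sum fun k _ => h1 k
    _ = 2 * E ^ 2 * (∑ k ∈ S, ‖μ k - μ' k‖ ^ 2 + (∑ k ∈ S, ‖μ' k - k‖ ^ 2) * (d ^ 2 * s)) := by
        rw [← Finset.mul_sum, Finset.sum_add_distrib, Finset.sum_mul]
    _ ≤ 2 * E ^ 2 * (d ^ 2 + r ^ 2 * (d ^ 2 * s)) := by
        have h3 : 0 ≤ s := tsum_nonneg fun _ => by positivity
        gcongr
        · exact (hδ.sum_le_tsum _ fun _ _ => by positivity).trans hδd
        · exact (hμ'.sum_le_tsum _ fun _ _ => by positivity).trans hμr'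
    _ = _ := by ring

theorem summable_sq_of_l2Norm_le {x : ℤ → ℂ} {r : ℝ} (hr : 0 ≤ r)
    (h : l2Norm x ≤ ENNReal.ofReal r) :
    (Summable fun n => ‖x n‖ ^ 2) ∧ ∑' n, ‖x n‖ ^ 2 ≤ r ^ 2 := by
  have hx : MemLp x 2 Measure.count :=
    ⟨Measurable.of_discrete.aestronglyMeasurable, h.trans_lt ENNReal.ofReal_lt_top⟩
  have h1 : Integrable (fun n => ‖x n‖ ^ 2) Measure.count := hx.integrable_norm_pow two_ne_zero
  refine ⟨by simpa using integrable_count_iff.1 h1, ?_⟩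
  rw [l2Norm, hx.eLpNorm_eq_integral_rpow_norm two_ne_zero ENNReal.ofNat_ne_top,
    ENNReal.ofReal_le_ofReal_iff hr] at h
  simp only [ENNReal.toReal_ofNat, Real.rpow_two] at h
  rw [integral_countable h1, Real.rpow_inv_le_iff_of_pos (tsum_nonneg fun _ => by
    simp only [smul_eq_mul]; positivity) hr (by norm_num), Real.rpow_two] at h
  simpa using h

/-! ### The exponential transform: growth, analyticity, Parseval -/

/-- The entire function of exponential type with density `ψ`, written on the delay interval. -/
noncomputable def delayTransform (a : ℝ) (ψ : ℝ → ℂ) (z : ℂ) : ℂ :=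
  ∫ t in a..Real.pi, ψ t * exp (I * z * (Real.pi + a - 2 * t))

theorem abs_delay_le {a t : ℝ} (ha : Real.pi / 2 ≤ a) (ht : t ∈ Set.Ioc a Real.pi) :
    |Real.pi + a - 2 * t| ≤ Real.pi / 2 :=
  abs_le.2 ⟨by linarith [ht.1, ht.2], by linarith [ht.1, ht.2]⟩

/-- On the delay interval `|π + a - 2t| ≤ π - a ≤ π/2`; this is where the exponential type drops
below that of `sin πz`. -/
theorem norm_exp_delay_le {a t : ℝ} (ha : Real.pi / 2 ≤ a) (ht : t ∈ Set.Ioc a Real.pi) (z : ℂ) :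
    ‖exp (I * z * (Real.pi + a - 2 * t))‖ ≤ Real.exp (Real.pi / 2 * |z.im|) := by
  rw [norm_exp]
  apply Real.exp_le_exp.2
  have h1 : (I * z * (Real.pi + a - 2 * t)).re = -(z.im * (Real.pi + a - 2 * t)) := by
    rw [show (Real.pi + a - 2 * t : ℂ) = ((Real.pi + a - 2 * t : ℝ) : ℂ) by push_cast; ring,
      re_mul_ofReal]
    simp
  rw [h1]
  refine (neg_le_abs _).trans ?_
  rw [abs_mul, mul_comm]
  gcongr
  exact abs_delay_le ha ht

theorem continuous_exp_delay (a : ℝ) (z : ℂ) :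
    Continuous fun t : ℝ => exp (I * z * (Real.pi + a - 2 * t)) := by fun_prop

theorem integrable_mul_exp_delay {a : ℝ} (ha : Real.pi / 2 ≤ a) {ψ : ℝ → ℂ}
    (hψ : Integrable ψ (volume.restrict (Set.Ioc a Real.pi))) (z : ℂ) :
    Integrable (fun t : ℝ => ψ t * exp (I * z * (Real.pi + a - 2 * t)))
      (volume.restrict (Set.Ioc a Real.pi)) := by
  refine hψ.mul_bdd (c := Real.exp (Real.pi / 2 * |z.im|))
    (continuous_exp_delay a z).aestronglyMeasurable ?_
  filter_upwards [ae_restrict_mem measurableSet_Ioc] with t ht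
  exact norm_exp_delay_le ha ht z

theorem norm_delayTransform_le {a : ℝ} (ha : Real.pi / 2 ≤ a) (ha' : a < Real.pi) {ψ : ℝ → ℂ}
    (hψ : Integrable ψ (volume.restrict (Set.Ioc a Real.pi))) (z : ℂ) :
    ‖delayTransform a ψ z‖ ≤
      (∫ t in Set.Ioc a Real.pi, ‖ψ t‖) * Real.exp (Real.pi / 2 * |z.im|) := by
  rw [delayTransform, intervalIntegral.integral_of_le ha'.le, ← integral_mul_const]
  refine norm_integral_le_of_norm_le (hψ.norm.mul_const _) ?_
  filter_upwards [ae_restrict_mem measurableSet_Ioc] with t ht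
  rw [norm_mul]
  gcongr
  exact norm_exp_delay_le ha ht z

theorem differentiable_delayTransform {a : ℝ} (ha : Real.pi / 2 ≤ a) (ha' : a < Real.pi)
    {ψ : ℝ → ℂ} (hψ : Integrable ψ (volume.restrict (Set.Ioc a Real.pi))) :
    Differentiable ℂ (delayTransform a ψ) := by
  intro z
  have h := hasDerivAt_integral_of_dominated_loc_of_deriv_le
    (μ := volume.restrict (Set.Ioc a Real.pi)) (x₀ := z) (s := Metric.ball z 1)
    (F := fun (w : ℂ) (t : ℝ) => ψ t * exp (I * w * (Real.pi + a - 2 * t)))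
    (F' := fun (w : ℂ) (t : ℝ) =>
      ψ t * (exp (I * w * (Real.pi + a - 2 * t)) * (I * (Real.pi + a - 2 * t))))
    (bound := fun t => ‖ψ t‖ * (Real.exp (Real.pi / 2 * (‖z‖ + 1)) * (Real.pi / 2)))
    (Metric.ball_mem_nhds z one_pos)
    (Eventually.of_forall fun w => (integrable_mul_exp_delay ha hψ w).aestronglyMeasurable)
    (integrable_mul_exp_delay ha hψ z)
    (hψ.aestronglyMeasurable.mul (Continuous.aestronglyMeasurable (by fun_prop)))
    (by
      filter_upwards [ae_restrict_mem measurableSet_Ioc] with t ht w hw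
      rw [norm_mul, norm_mul]
      gcongr
      · refine (norm_exp_delay_le ha ht w).trans (Real.exp_le_exp.2 ?_)
        gcongr
        refine (abs_im_le_norm w).trans ?_
        have h1 := norm_le_norm_add_norm_sub' w z
        rw [Metric.mem_ball, dist_eq_norm] at hw
        linarith
      · rw [norm_mul, norm_I, one_mul,
          show (Real.pi + a - 2 * t : ℂ) = ((Real.pi + a - 2 * t : ℝ) : ℂ) by push_cast; ring,
          norm_real]
        exact abs_delay_le ha ht)
    (hψ.norm.mul_const _)
    (Eventually.of_forall fun t w _ => by
      have h1 : HasDerivAt (fun w : ℂ => I * w * (Real.pi + a - 2 * t))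
          (I * (Real.pi + a - 2 * t)) w := by
        simpa using ((hasDerivAt_id w).const_mul I).mul_const (Real.pi + a - 2 * t : ℂ)
      exact h1.cexp.const_mul (ψ t))
  have h2 : delayTransform a ψ = fun w => ∫ t in Set.Ioc a Real.pi,
      ψ t * exp (I * w * (Real.pi + a - 2 * t)) := by
    funext w
    rw [delayTransform, intervalIntegral.integral_of_le ha'.le]
  rw [h2]
  exact h.2.differentiableAt

/-- Parseval's identity for `delayTransform`. -/
theorem hasSum_sq_norm_delayTransform {a : ℝ} (ha : 0 ≤ a) (ha' : a < Real.pi) {ψ : ℝ → ℂ}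
    (hψ : MemLp ψ 2 (volume.restrict (Set.Ioc a Real.pi))) :
    HasSum (fun k : ℤ => ‖delayTransform a ψ k‖ ^ 2)
      (Real.pi * ∫ t in Set.Ioc a Real.pi, ‖ψ t‖ ^ 2) := by
  have hsub : Set.Ioc a Real.pi ⊆ Set.Ioc 0 Real.pi := Set.Ioc_subset_Ioc_left ha
  set f : ℝ → ℂ := (Set.Ioc a Real.pi).indicator ψ with hf
  have hfL : MemLp f 2 (volume.restrict (Set.Ioc 0 Real.pi)) :=
    (memLp_indicator_iff_restrict measurableSet_Ioc).2 (by
      rwa [Measure.restrict_restrict measurableSet_Ioc, Set.inter_eq_left.2 hsub])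
  have h1 := (hasSum_sq_fourierCoeffOn Real.pi_pos hfL).mul_left (Real.pi ^ 2)
  have hk : (fun k : ℤ => ‖delayTransform a ψ k‖ ^ 2) =
      fun k => Real.pi ^ 2 * ‖fourierCoeffOn Real.pi_pos f k‖ ^ 2 := by
    funext k
    rw [fourierCoeffOn_eq_integral, norm_smul, mul_pow, ← mul_assoc]
    have h2 : Real.pi ^ 2 * ‖1 / (Real.pi - 0)‖ ^ 2 = 1 := by
      rw [sub_zero, Real.norm_of_nonneg (by positivity)]
      field_simp
    rw [h2, one_mul]
    congr 1
    -- With period `π` the character is `e^{-2ikx}`, which differs from the kernel `e^{ik(π+a-2x)}`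
    -- only by a unimodular constant.
    have h3 : ∫ x in (0 : ℝ)..Real.pi, fourier (-k) (x : AddCircle (Real.pi - 0)) • f x =
        exp (-(I * k * (Real.pi + a))) * delayTransform a ψ k := by
      rw [delayTransform, intervalIntegral.integral_of_le Real.pi_pos.le,
        intervalIntegral.integral_of_le ha'.le, ← integral_const_mul]
      have h4 : ∀ x : ℝ, fourier (-k) (x : AddCircle (Real.pi - 0)) • f x =
          (Set.Ioc a Real.pi).indicator (fun x : ℝ => exp (-(I * k * (Real.pi + a))) *
            (ψ x * exp (I * k * (Real.pi + a - 2 * x)))) x := by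
        intro x
        by_cases hx : x ∈ Set.Ioc a Real.pi
        · rw [hf, Set.indicator_of_mem hx, Set.indicator_of_mem hx, fourier_coe_apply, smul_eq_mul,
            mul_left_comm, ← Complex.exp_add, mul_comm]
          congr 2
          have : (Real.pi : ℂ) ≠ 0 := by exact_mod_cast Real.pi_ne_zero
          push_cast
          field_simp
          ring
        · rw [hf, Set.indicator_of_notMem hx, Set.indicator_of_notMem hx, smul_zero]
      simp only [h4]
      rw [setIntegral_indicator measurableSet_Ioc, Set.inter_eq_right.2 hsub]
    rw [h3, norm_mul, norm_exp]
    have h5 : (-(I * k * (Real.pi + a))).re = 0 := by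
      rw [show (-(I * k * (Real.pi + a)) : ℂ) = ((-(k * (Real.pi + a)) : ℝ) : ℂ) * I by
        push_cast; ring]
      simp
    rw [h5, Real.exp_zero, one_mul]
  have hI : Real.pi * ∫ t in Set.Ioc a Real.pi, ‖ψ t‖ ^ 2 =
      Real.pi ^ 2 * ((Real.pi - 0)⁻¹ • ∫ x in (0 : ℝ)..Real.pi, ‖f x‖ ^ 2) := by
    rw [sub_zero, smul_eq_mul, ← mul_assoc, intervalIntegral.integral_of_le Real.pi_pos.le]
    have h2 : Real.pi ^ 2 * Real.pi⁻¹ = Real.pi := by field_simp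
    have h4 : ∀ x : ℝ, ‖f x‖ ^ 2 = (Set.Ioc a Real.pi).indicator (fun x => ‖ψ x‖ ^ 2) x := by
      intro x
      by_cases hx : x ∈ Set.Ioc a Real.pi
      · rw [hf, Set.indicator_of_mem hx, Set.indicator_of_mem hx]
      · rw [hf, Set.indicator_of_notMem hx, Set.indicator_of_notMem hx]
        simp
    simp only [h4]
    rw [h2, setIntegral_indicator measurableSet_Ioc, Set.inter_eq_right.2 hsub]
  rw [hk, hI]
  exact h1

theorem delayTransform_sub {a : ℝ} (ha : Real.pi / 2 ≤ a) (ha' : a < Real.pi) {ψ ψ' : ℝ → ℂ}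
    (hψ : Integrable ψ (volume.restrict (Set.Ioc a Real.pi)))
    (hψ' : Integrable ψ' (volume.restrict (Set.Ioc a Real.pi))) (z : ℂ) :
    delayTransform a (fun t => ψ t - ψ' t) z = delayTransform a ψ z - delayTransform a ψ' z := by
  simp only [delayTransform, intervalIntegral.integral_of_le ha'.le, sub_mul]
  exact integral_sub (integrable_mul_exp_delay ha hψ z) (integrable_mul_exp_delay ha hψ' z)

/-! ### From zeros to densities -/

/-- Uniform stability of recovering the density of a sine-type function from its zeros. -/
theorem exists_density_stability (r : ℝ) (hr : 0 < r) :
    ∃ C : ℝ, 0 < C ∧ ∀ a : ℝ, Real.pi / 2 ≤ a → a < Real.pi → ∀ ψ ψ' : ℝ → ℂ,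
      MemLp ψ 2 (volume.restrict (Set.Ioc a Real.pi)) →
      MemLp ψ' 2 (volume.restrict (Set.Ioc a Real.pi)) → ∀ μ μ' : ℤ → ℂ,
      (∀ (S : Finset ℤ) (z : ℂ), ((S.filter fun n => μ n = z).card : ℕ∞) ≤
        analyticOrderAt (fun z => sin (Real.pi * z) + delayTransform a ψ z) z) →
      (∀ (S : Finset ℤ) (z : ℂ), ((S.filter fun n => μ' n = z).card : ℕ∞) ≤
        analyticOrderAt (fun z => sin (Real.pi * z) + delayTransform a ψ' z) z) →
      l2Norm (fun n => μ n - n) ≤ ENNReal.ofReal r →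
      l2Norm (fun n => μ' n - n) ≤ ENNReal.ofReal r →
      eLpNorm (fun t => ψ t - ψ' t) 2 (volume.restrict (Set.Ioc a Real.pi)) ≤
        ENNReal.ofReal C * l2Norm (fun n => μ n - μ' n) := by
  set B : ℝ := 2 * (Real.pi * Real.exp (2 * (r * √(∑' n : ℤ, 1 / (n : ℝ) ^ 2)))) ^ 2 *
    (1 + r ^ 2 * ∑' n : ℤ, 1 / (n : ℝ) ^ 2) with hB
  have hs0 : 0 ≤ ∑' n : ℤ, 1 / (n : ℝ) ^ 2 := tsum_nonneg fun _ => by positivity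
  have hB0 : 0 < B := by positivity
  -- Parseval gives `π ‖ψ - ψ'‖² ≤ B d²`.
  refine ⟨√(B / Real.pi), by positivity, ?_⟩
  intro a ha ha' ψ ψ' hψ hψ' μ μ' hord hord' hμ hμ'
  have hψ1 : Integrable ψ (volume.restrict (Set.Ioc a Real.pi)) := hψ.integrable one_le_two
  have hψ1' : Integrable ψ' (volume.restrict (Set.Ioc a Real.pi)) := hψ'.integrable one_le_two
  by_cases hδ : l2Norm (fun n => μ n - μ' n) = ⊤
  · rw [hδ, ENNReal.mul_top (by rw [Ne, ENNReal.ofReal_eq_zero, not_le]; positivity)]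
    exact le_top
  obtain ⟨hμs, hμr⟩ := summable_sq_of_l2Norm_le hr.le hμ
  obtain ⟨hμs', hμr'⟩ := summable_sq_of_l2Norm_le hr.le hμ'
  set d := (l2Norm (fun n => μ n - μ' n)).toReal with hd
  have hd0 : 0 ≤ d := ENNReal.toReal_nonneg
  obtain ⟨hδs, hδd⟩ := summable_sq_of_l2Norm_le hd0 (ENNReal.ofReal_toReal hδ).ge
  have hsin : Differentiable ℂ fun w : ℂ => sin (Real.pi * w) :=
    fun z => (hasDerivAt_sin_pi_mul z).differentiableAt
  have key : ∀ (ψ : ℝ → ℂ) (μ : ℤ → ℂ), Integrable ψ (volume.restrict (Set.Ioc a Real.pi)) →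
      (∀ (S : Finset ℤ) (z : ℂ), ((S.filter fun n => μ n = z).card : ℕ∞) ≤
        analyticOrderAt (fun z => sin (Real.pi * z) + delayTransform a ψ z) z) →
      (Summable fun n : ℤ => ‖μ n - n‖ ^ 2) → ∀ k : ℤ,
      Tendsto (fun N : ℕ => Real.pi * cos (Real.pi * k) * (k - μ k) *
        ∏ n ∈ (Finset.Icc (-N : ℤ) N).erase k, (k - μ n) / ((k : ℂ) - n)) atTop
        (𝓝 (sin (Real.pi * k) + delayTransform a ψ k)) := by
    intro ψ μ hψ hord hμ k
    refine tendsto_prod_zeros (F := fun z => sin (Real.pi * z) + delayTransform a ψ z)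
      (M := ∫ t in Set.Ioc a Real.pi, ‖ψ t‖)
      (hsin.add (differentiable_delayTransform ha ha' hψ))
      (integral_nonneg fun t => norm_nonneg (ψ t)) (fun z => ?_) hμ hord k
    rw [add_sub_cancel_left]
    exact norm_delayTransform_le ha ha' hψ z
  have hsum := sum_norm_value_sub_sq_le hr.le hd0 hμs hμr hμs' hμr' hδs hδd
    (key ψ μ hψ1 hord hμs) (key ψ' μ' hψ1' hord' hμs')
  have hpars := hasSum_sq_norm_delayTransform (by linarith [Real.pi_pos]) ha' (hψ.sub hψ')
  have h1 : Real.pi * ∫ t in Set.Ioc a Real.pi, ‖(ψ - ψ') t‖ ^ 2 ≤ B * d ^ 2 := by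
    refine hasSum_le_of_sum_le hpars fun S => ?_
    refine le_trans (le_of_eq (Finset.sum_congr rfl fun k _ => ?_)) (hsum S)
    rw [add_sub_add_left_eq_sub, ← delayTransform_sub ha ha' hψ1 hψ1']
    rfl
  have h2 := (hψ.sub hψ').eLpNorm_eq_integral_rpow_norm two_ne_zero ENNReal.ofNat_ne_top
  simp only [ENNReal.toReal_ofNat, Real.rpow_two] at h2
  change eLpNorm (ψ - ψ') 2 _ ≤ _
  rw [h2, ← ENNReal.ofReal_toReal hδ, ← hd, ← ENNReal.ofReal_mul (Real.sqrt_nonneg _)]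
  apply ENNReal.ofReal_le_ofReal
  rw [Real.rpow_inv_le_iff_of_pos (integral_nonneg fun _ => by positivity) (by positivity)
    (by norm_num), Real.rpow_two, mul_pow, Real.sq_sqrt (by positivity)]
  rw [div_mul_eq_mul_div, le_div_iff₀ Real.pi_pos]
  linarith

/-! ### Explicit solution of the delay system -/

theorem absolutelyContinuous_clm_comp {E G : Type*} [NormedAddCommGroup E] [NormedSpace ℝ E]
    [NormedAddCommGroup G] [NormedSpace ℝ G] (L : E →L[ℝ] G) {f : ℝ → E} {a b : ℝ}
    (hf : AbsolutelyContinuousOnInterval f a b) :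
    AbsolutelyContinuousOnInterval (fun x => L (f x)) a b := by
  refine squeeze_zero (fun t => Finset.sum_nonneg fun _ _ => dist_nonneg) (fun t => ?_)
    (by simpa using Tendsto.const_mul ‖L‖ hf)
  rw [Finset.mul_sum]
  exact Finset.sum_le_sum fun i _ => L.lipschitz.dist_le_mul _ _

/-- The fundamental theorem of calculus for complex-valued absolutely continuous functions. -/
theorem integral_eq_sub_of_absolutelyContinuous {f φ : ℝ → ℂ} {a b : ℝ} (hab : a ≤ b)
    (hf : AbsolutelyContinuousOnInterval f a b) (hφ : IntervalIntegrable φ volume a b)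
    (hd : ∀ᵐ x ∂volume.restrict (Set.Ioo a b), HasDerivAt f (φ x) x) :
    ∫ x in a..b, φ x = f b - f a := by
  have key : ∀ L : ℂ →L[ℝ] ℝ, L (∫ x in a..b, φ x) = L (f b - f a) := by
    intro L
    rw [← L.intervalIntegral_comp_comm hφ, map_sub,
      ← (absolutelyContinuous_clm_comp L hf).integral_deriv_eq_sub,
      intervalIntegral.integral_of_le hab, intervalIntegral.integral_of_le hab,
      Measure.restrict_congr_set Ioo_ae_eq_Ioc.symm]
    refine integral_congr_ae ?_
    filter_upwards [hd] with x hx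
    exact (L.hasFDerivAt.comp_hasDerivAt x hx).deriv.symm
  exact Complex.ext (key reCLM) (key imCLM)

theorem IsAdmissible.memLp_Ioc {a : ℝ} {f : ℝ → ℂ} (ha : 0 ≤ a) (hf : IsAdmissible a f) :
    MemLp f 2 (volume.restrict (Set.Ioc a Real.pi)) := by
  rw [← Measure.restrict_congr_set Ioo_ae_eq_Ioc]
  exact hf.memLp.mono_measure (Measure.restrict_mono (Set.Ioo_subset_Ioo_left ha) le_rfl)

section Solution

variable {a : ℝ} {q p : ℝ → ℂ} {z : ℂ} {y : ℝ → Fin 2 → ℂ}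

theorem IsSolution.absolutelyContinuous_gauge (h : IsSolution a (potential q p) z y) (σ : ℂ) :
    AbsolutelyContinuousOnInterval
      (fun x : ℝ => exp (-(σ * I * z) * x) * (y x 0 + σ * I * y x 1)) 0 Real.pi := by
  have h1 : AbsolutelyContinuousOnInterval (fun x : ℝ => exp (-(σ * I * z) * x)) 0 Real.pi := by
    apply ContDiffOn.absolutelyContinuousOnInterval
    exact (contDiff_const.mul Complex.ofRealCLM.contDiff).cexp.contDiffOn
  have h2 := absolutelyContinuous_clm_comp
    (((ContinuousLinearMap.proj (R := ℂ) (φ := fun _ : Fin 2 => ℂ) 0) +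
      (σ * I) • (ContinuousLinearMap.proj (R := ℂ) (φ := fun _ : Fin 2 => ℂ) 1)).restrictScalars ℝ)
    h.absolutelyContinuous
  exact h1.smul h2

/-- The combinations `y₁ + σ i y₂` with `σ = ±1` diagonalize the unperturbed system, and the
exponential factor removes its flow. The potential interchanges the two, so the delayed term carries
`-σ`. -/
theorem IsSolution.hasDerivAt_gauge (h : IsSolution a (potential q p) z y) {σ : ℂ}
    (hσ : σ ^ 2 = 1) :
    ∀ᵐ (x : ℝ) ∂volume.restrict (Set.Ioo 0 Real.pi),
      HasDerivAt (fun x : ℝ => exp (-(σ * I * z) * x) * (y x 0 + σ * I * y x 1))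
        (exp (-(σ * I * z) * x) *
          ((p x - σ * I * q x) * (y (x - a) 0 - σ * I * y (x - a) 1))) x := by
  filter_upwards [h.equation] with x ⟨y', hy', he⟩
  have e0 := congr_fun he 0
  have e1 := congr_fun he 1
  simp only [B, potential, Matrix.mulVec, dotProduct, Fin.sum_univ_two, Pi.add_apply,
    Pi.smul_apply, smul_eq_mul, Matrix.of_apply, Matrix.cons_val_zero, Matrix.cons_val_one,
    zero_mul, one_mul, zero_add, add_zero] at e0 e1
  rw [hasDerivAt_pi] at hy'
  have h1 : HasDerivAt (fun x : ℝ => exp (-(σ * I * z) * x))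
      (exp (-(σ * I * z) * x) * -(σ * I * z)) x := by
    have : HasDerivAt (fun x : ℝ => -(σ * I * z) * (x : ℂ)) (-(σ * I * z)) x := by
      simpa using (Complex.ofRealCLM.hasDerivAt (x := x)).const_mul (-(σ * I * z))
    exact this.cexp
  have h2 := h1.mul ((hy' 0).add ((hy' 1).const_mul (σ * I)))
  refine h2.congr_deriv ?_
  have hI := I_sq
  simp only [Pi.add_apply]
  linear_combination exp (-(σ * I * z) * x) * (σ * I * e0 - e1 -
    (I ^ 2 * z * y x 1 + I ^ 2 * y (x - a) 1 * q x) * hσ - (y (x - a) 1 * q x + z * y x 1) * hI)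

theorem IsSolution.gauge_eq_of_le (ha' : a < Real.pi)
    (hq : IsAdmissible a q) (hp : IsAdmissible a p) (h : IsSolution a (potential q p) z y)
    (hy : y 0 = ![0, 1]) {σ : ℂ} (hσ : σ ^ 2 = 1) {x : ℝ} (hx : x ∈ Set.Icc 0 a) :
    y x 0 + σ * I * y x 1 = σ * I * exp (σ * I * z * x) := by
  have hac := (h.absolutelyContinuous_gauge σ).mono (c := 0) (d := x) (by
    rw [Set.uIcc_of_le hx.1, Set.uIcc_of_le Real.pi_pos.le]
    exact Set.Icc_subset_Icc_right (hx.2.trans ha'.le))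
  have h1 := integral_eq_sub_of_absolutelyContinuous (φ := fun _ => 0) hx.1 hac
    intervalIntegrable_const (by
      have h2 := ae_restrict_of_ae_restrict_of_subset
        (show Set.Ioo 0 x ⊆ Set.Ioo 0 Real.pi from Set.Ioo_subset_Ioo_right (hx.2.trans ha'.le)) (h.hasDerivAt_gauge hσ)
      have h3 := ae_restrict_of_ae_restrict_of_subset (show Set.Ioo 0 x ⊆ Set.Ioo 0 a from Set.Ioo_subset_Ioo_right hx.2) hq.eq_zero
      have h4 := ae_restrict_of_ae_restrict_of_subset (show Set.Ioo 0 x ⊆ Set.Ioo 0 a from Set.Ioo_subset_Ioo_right hx.2) hp.eq_zero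
      filter_upwards [h2, h3, h4] with t ht hqt hpt
      refine ht.congr_deriv ?_
      rw [hqt, hpt]
      ring)
  simp only [intervalIntegral.integral_zero, hy, ofReal_zero, mul_zero, Complex.exp_zero,
    Matrix.cons_val_zero, Matrix.cons_val_one, zero_add, mul_one, one_mul] at h1
  have h2 : exp (σ * I * z * x) * exp (-(σ * I * z) * x) = 1 := by
    rw [← Complex.exp_add]
    ring_nf
    simp
  linear_combination (-exp (σ * I * z * x)) * h1 - (y x 0 + σ * I * y x 1) * h2

/-- For `t ∈ (a, π)` the delayed point `t - a` is in `[0, a]`, where `gauge_eq_of_le` with `-σ`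
gives the solution. Integrating the gauged derivative once over `(0, π)` is thus exact. -/
theorem IsSolution.gauge_pi (ha : Real.pi / 2 ≤ a) (ha' : a < Real.pi)
    (hq : IsAdmissible a q) (hp : IsAdmissible a p) (h : IsSolution a (potential q p) z y)
    (hy : y 0 = ![0, 1]) {σ : ℂ} (hσ : σ ^ 2 = 1) :
    y Real.pi 0 + σ * I * y Real.pi 1 = σ * I * exp (σ * I * z * Real.pi) -
      ∫ t in a..Real.pi, (q t + σ * I * p t) * exp (σ * I * z * (Real.pi + a - 2 * t)) := by
  have ha0 : 0 < a := by linarith [Real.pi_pos]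
  set ρ : ℝ → ℂ := fun t => -((q t + σ * I * p t) * exp (σ * I * z * (a - 2 * t))) with hρ
  have hρi : Integrable ρ (volume.restrict (Set.Ioc a Real.pi)) := by
    have h1 : IntervalIntegrable (fun t => q t + σ * I * p t) volume a Real.pi :=
      (intervalIntegrable_iff_integrableOn_Ioc_of_le ha'.le).2
        (((hq.memLp_Ioc ha0.le).integrable one_le_two).add
          (((hp.memLp_Ioc ha0.le).integrable one_le_two).const_mul _))
    exact (intervalIntegrable_iff_integrableOn_Ioc_of_le ha'.le).1
      (h1.mul_continuousOn (g := fun t : ℝ => exp (σ * I * z * (a - 2 * t)))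
        (by fun_prop)).neg
  have hsub : Set.Ioc a Real.pi ⊆ Set.Ioc 0 Real.pi := Set.Ioc_subset_Ioc_left ha0.le
  have h1 := integral_eq_sub_of_absolutelyContinuous (φ := (Set.Ioc a Real.pi).indicator ρ)
    Real.pi_pos.le (h.absolutelyContinuous_gauge σ)
    ((intervalIntegrable_iff_integrableOn_Ioc_of_le Real.pi_pos.le).2
      ((integrable_indicator_iff measurableSet_Ioc).2 hρi).integrableOn) (by
      have h3 := (ae_restrict_iff' measurableSet_Ioo).1 hq.eq_zero
      have h4 := (ae_restrict_iff' measurableSet_Ioo).1 hp.eq_zero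
      have h5 : ∀ᵐ t : ℝ, t ≠ a := Measure.ae_ne volume a
      filter_upwards [h.hasDerivAt_gauge hσ, ae_restrict_mem measurableSet_Ioo,
        ae_restrict_of_ae h3, ae_restrict_of_ae h4, ae_restrict_of_ae h5] with t ht htm hqt hpt hta
      refine ht.congr_deriv ?_
      rcases lt_or_gt_of_ne hta with hlt | hgt
      · rw [Set.indicator_of_notMem fun hm => absurd hm.1 (not_lt.2 hlt.le), hqt ⟨htm.1, hlt⟩,
          hpt ⟨htm.1, hlt⟩]
        ring
      · rw [Set.indicator_of_mem (show t ∈ Set.Ioc a Real.pi from ⟨hgt, htm.2.le⟩)]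
        have h6 := h.gauge_eq_of_le ha' hq hp hy (σ := -σ) (by rw [neg_sq, hσ]) (x := t - a)
          ⟨by linarith, by linarith [htm.2]⟩
        have h7 : y (t - a) 0 - σ * I * y (t - a) 1 =
            -σ * I * exp (-σ * I * z * (t - a : ℝ)) := by
          rw [← h6]
          ring
        have h8 : exp (-(σ * I * z) * t) * exp (-σ * I * z * (t - a : ℝ)) =
            exp (σ * I * z * (a - 2 * t)) := by
          rw [← Complex.exp_add]
          congr 1
          push_cast
          ring
        rw [h7, hρ]
        simp only
        rw [← h8]
        have hI := I_sq
        linear_combination exp (-(σ * I * z) * t) * exp (-σ * I * z * (t - a : ℝ)) * q t *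
          (I ^ 2 * hσ + hI))
  rw [intervalIntegral.integral_of_le Real.pi_pos.le, setIntegral_indicator measurableSet_Ioc,
    Set.inter_eq_right.2 hsub] at h1
  simp only [hy, ofReal_zero, mul_zero, Complex.exp_zero,
    Matrix.cons_val_zero, Matrix.cons_val_one, zero_add, mul_one, one_mul] at h1
  have h2 : exp (σ * I * z * Real.pi) * exp (-(σ * I * z) * Real.pi) = 1 := by
    rw [← Complex.exp_add]
    ring_nf
    simp
  have h3 : ∫ t in a..Real.pi, (q t + σ * I * p t) * exp (σ * I * z * (Real.pi + a - 2 * t)) =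
      -(exp (σ * I * z * Real.pi) * ∫ t in Set.Ioc a Real.pi, ρ t) := by
    rw [intervalIntegral.integral_of_le ha'.le, ← integral_const_mul, ← integral_neg]
    congr 1
    funext t
    have h4 : exp (σ * I * z * (Real.pi + a - 2 * t)) =
        exp (σ * I * z * Real.pi) * exp (σ * I * z * (a - 2 * t)) := by
      rw [← Complex.exp_add]
      congr 1
      ring
    rw [h4, hρ]
    ring
  rw [h3]
  linear_combination (-exp (σ * I * z * Real.pi)) * h1 -
    (y Real.pi 0 + σ * I * y Real.pi 1) * h2

end Solution

/-! ### Characteristic functions as perturbed sines -/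

theorem measurePreserving_reflection (a : ℝ) :
    MeasurePreserving (fun t : ℝ => Real.pi + a - t) (volume.restrict (Set.Ioc a Real.pi))
      (volume.restrict (Set.Ioc a Real.pi)) := by
  have h := (Measure.measurePreserving_sub_left volume (Real.pi + a)).restrict_preimage
    (measurableSet_Ioo (a := a) (b := Real.pi))
  have h1 : (fun t : ℝ => Real.pi + a - t) ⁻¹' Set.Ioo a Real.pi = Set.Ioo a Real.pi := by
    rw [Set.preimage_const_sub_Ioo]
    congr 1 <;> ring
  rwa [h1, Measure.restrict_congr_set Ioo_ae_eq_Ioc] at h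

theorem eLpNorm_reflection {a : ℝ} {f : ℝ → ℂ}
    (hf : AEStronglyMeasurable f (volume.restrict (Set.Ioc a Real.pi))) :
    eLpNorm (fun t => f (Real.pi + a - t)) 2 (volume.restrict (Set.Ioc a Real.pi)) =
      eLpNorm f 2 (volume.restrict (Set.Ioc a Real.pi)) :=
  eLpNorm_comp_measurePreserving hf (measurePreserving_reflection a)

/-- The reflection `t ↦ π + a - t` changes the sign of `π + a - 2t`, so the `σ = -1` integral
becomes a transform with the same kernel as the `σ = 1` one. -/
theorem delayTransform_reflection (a : ℝ) (f : ℝ → ℂ) (z : ℂ) :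
    delayTransform a (fun t => f (Real.pi + a - t)) z =
      ∫ t in a..Real.pi, f t * exp (-(I * z * (Real.pi + a - 2 * t))) := by
  have h := intervalIntegral.integral_comp_sub_left (a := a) (b := Real.pi)
    (fun t : ℝ => f t * exp (-(I * z * (Real.pi + a - 2 * t)))) (Real.pi + a)
  rw [add_sub_cancel_left, add_sub_cancel_right] at h
  rw [← h, delayTransform]
  congr 1
  funext t
  congr 2
  push_cast
  ring

/-- The densities of the sine-type functions associated with the two characteristic functions. -/
noncomputable def density (a : ℝ) (q p : ℝ → ℂ) : Fin 2 → ℝ → ℂ :=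
  ![fun t => (1 / 2) * ((q t + I * p t) +
      (q (Real.pi + a - t) - I * p (Real.pi + a - t))),
    fun t => I / 2 * ((q t + I * p t) -
      (q (Real.pi + a - t) - I * p (Real.pi + a - t))) *
      exp (I * (-1 / 2) * (Real.pi + a - 2 * t))]

theorem density_zero (a : ℝ) (q p : ℝ → ℂ) (t : ℝ) : density a q p 0 t =
    (1 / 2) * ((q t + I * p t) + (q (Real.pi + a - t) - I * p (Real.pi + a - t))) := rfl

theorem density_one (a : ℝ) (q p : ℝ → ℂ) (t : ℝ) : density a q p 1 t =
    I / 2 * ((q t + I * p t) - (q (Real.pi + a - t) - I * p (Real.pi + a - t))) *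
      exp (I * (-1 / 2) * (Real.pi + a - 2 * t)) := rfl

section CharFun

variable {a : ℝ} {q p : ℝ → ℂ}

theorem IsAdmissible.memLp_reflection (ha : 0 ≤ a) (hq : IsAdmissible a q)
    (hp : IsAdmissible a p) :
    MemLp (fun t => q (Real.pi + a - t) - I * p (Real.pi + a - t)) 2
      (volume.restrict (Set.Ioc a Real.pi)) :=
  ((hq.memLp_Ioc ha).sub ((hp.memLp_Ioc ha).const_mul I)).comp_measurePreserving
    (measurePreserving_reflection a)

theorem memLp_density (ha : Real.pi / 2 ≤ a) (hq : IsAdmissible a q) (hp : IsAdmissible a p)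
    (j : Fin 2) : MemLp (density a q p j) 2 (volume.restrict (Set.Ioc a Real.pi)) := by
  have ha0 : 0 ≤ a := by linarith [Real.pi_pos]
  have h1 : MemLp (fun t => q t + I * p t) 2 (volume.restrict (Set.Ioc a Real.pi)) :=
    (hq.memLp_Ioc ha0).add ((hp.memLp_Ioc ha0).const_mul I)
  have h2 := hq.memLp_reflection ha0 hp
  fin_cases j
  · exact (h1.add h2).const_mul (1 / 2)
  · have h3 := (h1.sub h2).const_mul (I / 2)
    refine MemLp.of_le_mul (c := Real.exp (Real.pi / 2 * |(-1 / 2 : ℂ).im|)) h3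
      (h3.aestronglyMeasurable.mul (continuous_exp_delay a (-1 / 2)).aestronglyMeasurable) ?_
    filter_upwards [ae_restrict_mem measurableSet_Ioc] with t ht
    change ‖I / 2 * ((q t + I * p t) - (q (Real.pi + a - t) - I * p (Real.pi + a - t))) *
      exp (I * (-1 / 2) * (Real.pi + a - 2 * t))‖ ≤ _
    rw [norm_mul, mul_comm]
    gcongr
    · exact norm_exp_delay_le ha ht _
    · rfl

theorem IsCharFun.eq_transform (ha : Real.pi / 2 ≤ a) (ha' : a < Real.pi)
    (hq : IsAdmissible a q) (hp : IsAdmissible a p) {j : Fin 2} {D : ℂ → ℂ}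
    (hD : IsCharFun a (potential q p) j D) (z : ℂ) :
    ∃ y0 y1 : ℂ, D z = ![y0, y1] j ∧
      y0 + I * y1 = I * exp (I * z * Real.pi) -
        delayTransform a (fun t => q t + I * p t) z ∧
      y0 - I * y1 = -I * exp (-(I * z * Real.pi)) -
        delayTransform a (fun t => q (Real.pi + a - t) - I * p (Real.pi + a - t)) z := by
  obtain ⟨y, hy, hy0, hDy⟩ := hD z
  refine ⟨y Real.pi 0, y Real.pi 1, ?_, ?_, ?_⟩
  · rw [hDy]
    fin_cases j <;> rfl
  · have := hy.gauge_pi ha ha' hq hp hy0 (σ := 1) (by norm_num)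
    simp only [one_mul] at this
    exact this
  · have := hy.gauge_pi ha ha' hq hp hy0 (σ := -1) (by norm_num)
    rw [delayTransform_reflection a (fun t => q t - I * p t)]
    simp only [neg_mul, one_mul, ← sub_eq_add_neg] at this
    rw [this, neg_mul]

theorem IsCharFun.sin_add_zero (ha : Real.pi / 2 ≤ a) (ha' : a < Real.pi)
    (hq : IsAdmissible a q) (hp : IsAdmissible a p) {D : ℂ → ℂ}
    (hD : IsCharFun a (potential q p) 0 D) :
    (fun z => sin (Real.pi * z) + delayTransform a (density a q p 0) z) = -D := by
  have ha0 : 0 ≤ a := by linarith [Real.pi_pos]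
  have h1 : Integrable (fun t => q t + I * p t) (volume.restrict (Set.Ioc a Real.pi)) :=
    ((hq.memLp_Ioc ha0).add ((hp.memLp_Ioc ha0).const_mul I)).integrable one_le_two
  have h2 := (hq.memLp_reflection ha0 hp).integrable one_le_two
  funext z
  obtain ⟨y0, y1, hDz, e1, e2⟩ := hD.eq_transform ha ha' hq hp z
  have h3 : delayTransform a (density a q p 0) z = (1 / 2) *
      (delayTransform a (fun t => q t + I * p t) z +
        delayTransform a (fun t => q (Real.pi + a - t) - I * p (Real.pi + a - t)) z) := by
    simp only [delayTransform, intervalIntegral.integral_of_le ha'.le]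
    rw [← integral_add (integrable_mul_exp_delay ha h1 z) (integrable_mul_exp_delay ha h2 z),
      ← integral_const_mul]
    congr 1
    funext t
    simp only [density_zero]
    ring
  have h4 : sin (Real.pi * z) = -(I * exp (I * z * Real.pi) - I * exp (-(I * z * Real.pi))) / 2 := by
    rw [Complex.sin, show -(Real.pi * z) * I = -(I * z * Real.pi) by ring,
      show Real.pi * z * I = I * z * Real.pi by ring]
    ring
  simp only [Pi.neg_apply, hDz, Matrix.cons_val_zero]
  rw [h3, h4]
  linear_combination (1 / 2) * e1 + (1 / 2) * e2

/-- Here the leading term is `cos πz = sin π(z + 1/2)`. Passing to the variable `z + 1/2` puts the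
model zeros at integers, and the phase in `density` compensates for the shift inside the kernel. -/
theorem IsCharFun.sin_add_one (ha : Real.pi / 2 ≤ a) (ha' : a < Real.pi)
    (hq : IsAdmissible a q) (hp : IsAdmissible a p) {D : ℂ → ℂ}
    (hD : IsCharFun a (potential q p) 1 D) :
    (fun z => sin (Real.pi * z) + delayTransform a (density a q p 1) z) =
      D ∘ fun z => z - 1 / 2 := by
  have ha0 : 0 ≤ a := by linarith [Real.pi_pos]
  have h1 : Integrable (fun t => q t + I * p t) (volume.restrict (Set.Ioc a Real.pi)) :=
    ((hq.memLp_Ioc ha0).add ((hp.memLp_Ioc ha0).const_mul I)).integrable one_le_two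
  have h2 := (hq.memLp_reflection ha0 hp).integrable one_le_two
  funext w
  obtain ⟨z, rfl⟩ : ∃ z : ℂ, w = z + 1 / 2 := ⟨w - 1 / 2, by ring⟩
  obtain ⟨y0, y1, hDz, e1, e2⟩ := hD.eq_transform ha ha' hq hp z
  have h3 : delayTransform a (density a q p 1) (z + 1 / 2) = I / 2 *
      (delayTransform a (fun t => q t + I * p t) z -
        delayTransform a (fun t => q (Real.pi + a - t) - I * p (Real.pi + a - t)) z) := by
    simp only [delayTransform, intervalIntegral.integral_of_le ha'.le]
    rw [← integral_sub (integrable_mul_exp_delay ha h1 z) (integrable_mul_exp_delay ha h2 z),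
      ← integral_const_mul]
    congr 1
    funext t
    simp only [density_one]
    have : exp (I * z * (Real.pi + a - 2 * t)) = exp (I * (-1 / 2) * (Real.pi + a - 2 * t)) *
        exp (I * (z + 1 / 2) * (Real.pi + a - 2 * t)) := by
      rw [← Complex.exp_add]
      congr 1
      ring
    rw [this]
    ring
  have h4 : sin (Real.pi * (z + 1 / 2)) = (exp (I * z * Real.pi) + exp (-(I * z * Real.pi))) / 2 := by
    rw [show (Real.pi : ℂ) * (z + 1 / 2) = Real.pi * z + Real.pi / 2 by ring, sin_add_pi_div_two,
      Complex.cos, show -(Real.pi * z) * I = -(I * z * Real.pi) by ring,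
      show Real.pi * z * I = I * z * Real.pi by ring]
  simp only [Function.comp, add_sub_cancel_right, hDz, Matrix.cons_val_one, Matrix.cons_val_fin_one]
  rw [h3, h4]
  have hI := I_sq
  linear_combination (I / 2) * e1 - (I / 2) * e2 + (-y1 +
    (exp (I * z * Real.pi) + exp (-(I * z * Real.pi))) / 2) * hI

theorem card_filter_le_of_encard_eq {lam : ℤ → ℂ} {z : ℂ} {m : ℕ∞}
    (h : {n : ℤ | lam n = z}.encard = m) (S : Finset ℤ) :
    ((S.filter fun n => lam n = z).card : ℕ∞) ≤ m := by
  rw [← h, ← Set.encard_coe_eq_coe_finsetCard]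
  refine Set.encard_le_encard fun n hn => ?_
  simp only [Finset.coe_filter, Set.mem_ofPred_eq] at hn
  exact hn.2

theorem IsSpectrum.card_le_zero (ha : Real.pi / 2 ≤ a) (ha' : a < Real.pi)
    (hq : IsAdmissible a q) (hp : IsAdmissible a p) {lam : ℤ → ℂ}
    (h : IsSpectrum a (potential q p) 0 lam) (S : Finset ℤ) (z : ℂ) :
    ((S.filter fun n => lam n = z).card : ℕ∞) ≤
      analyticOrderAt (fun z => sin (Real.pi * z) + delayTransform a (density a q p 0) z) z := by
  obtain ⟨D, hD, hlam⟩ := h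
  rw [hD.sin_add_zero ha ha' hq hp, analyticOrderAt_neg]
  exact card_filter_le_of_encard_eq (hlam z) S

theorem IsSpectrum.card_le_one (ha : Real.pi / 2 ≤ a) (ha' : a < Real.pi)
    (hq : IsAdmissible a q) (hp : IsAdmissible a p) {lam : ℤ → ℂ}
    (h : IsSpectrum a (potential q p) 1 lam) (S : Finset ℤ) (z : ℂ) :
    ((S.filter fun n => lam n + 1 / 2 = z).card : ℕ∞) ≤
      analyticOrderAt (fun z => sin (Real.pi * z) + delayTransform a (density a q p 1) z) z := by
  obtain ⟨D, hD, hlam⟩ := h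
  have hd : HasDerivAt (fun z : ℂ => z - 1 / 2) 1 z := (hasDerivAt_id z).sub_const _
  rw [hD.sin_add_one ha ha' hq hp, analyticOrderAt_comp_of_deriv_ne_zero (by fun_prop)
    (by rw [hd.deriv]; exact one_ne_zero)]
  have := card_filter_le_of_encard_eq (hlam (z - 1 / 2)) S
  simpa only [eq_sub_iff_add_eq] using this

end CharFun

/-! ### Recovering the coefficients from the densities -/

theorem eLpNorm_le_add_of_gauge {ν : Measure ℝ} {u v g h : ℝ → ℂ} (hg : AEStronglyMeasurable g ν)
    (hh : AEStronglyMeasurable h ν) (hgu : ∀ t, g t = u t + I * v t)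
    (hhu : ∀ t, h t = u t - I * v t) :
    eLpNorm u 2 ν ≤ eLpNorm g 2 ν + eLpNorm h 2 ν ∧
      eLpNorm v 2 ν ≤ eLpNorm g 2 ν + eLpNorm h 2 ν := by
  constructor
  · have h1 : eLpNorm u 2 ν ≤ eLpNorm (g + h) 2 ν := eLpNorm_mono fun t => by
      rw [Pi.add_apply, hgu, hhu, show u t + I * v t + (u t - I * v t) = 2 * u t by ring, norm_mul,
        norm_ofNat]
      linarith [norm_nonneg (u t)]
    exact h1.trans (eLpNorm_add_le hg hh one_le_two)
  · have h1 : eLpNorm v 2 ν ≤ eLpNorm (g - h) 2 ν := eLpNorm_mono fun t => by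
      rw [Pi.sub_apply, hgu, hhu, show u t + I * v t - (u t - I * v t) = 2 * (I * v t) by ring,
        norm_mul, norm_mul, norm_I, norm_ofNat]
      linarith [norm_nonneg (v t)]
    exact h1.trans (eLpNorm_sub_le hg hh one_le_two)

/-- Up to unimodular factors the density differences are half the sum and half the difference of `g`
and the reflected `h`. Hence `g` and `h` are each bounded by the two density norms together; the
differences of `q` and of `p` are each bounded by the norms of `g` and `h` together, so the constant
is `4`. -/
theorem eLpNorm_sub_le_density {a : ℝ} (ha : Real.pi / 2 ≤ a) {q p q' p' : ℝ → ℂ}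
    (hq : IsAdmissible a q) (hp : IsAdmissible a p) (hq' : IsAdmissible a q')
    (hp' : IsAdmissible a p') :
    L2Norm a (fun x => q x - q' x) + L2Norm a (fun x => p x - p' x) ≤
      4 * (eLpNorm (fun t => density a q p 0 t - density a q' p' 0 t) 2
          (volume.restrict (Set.Ioc a Real.pi)) +
        eLpNorm (fun t => density a q p 1 t - density a q' p' 1 t) 2
          (volume.restrict (Set.Ioc a Real.pi))) := by
  have ha0 : 0 ≤ a := by linarith [Real.pi_pos]
  simp only [L2Norm, Measure.restrict_congr_set Ioo_ae_eq_Ioc]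
  set ν := volume.restrict (Set.Ioc a Real.pi) with hν
  set d0 : ℝ → ℂ := fun t => density a q p 0 t - density a q' p' 0 t with hd0
  set d1 : ℝ → ℂ := fun t => density a q p 1 t - density a q' p' 1 t with hd1
  have hqm := (hq.memLp_Ioc ha0).sub (hq'.memLp_Ioc ha0)
  have hpm := ((hp.memLp_Ioc ha0).sub (hp'.memLp_Ioc ha0)).const_mul I
  set g : ℝ → ℂ := fun t => (q t - q' t) + I * (p t - p' t) with hg
  set h : ℝ → ℂ := fun t => (q t - q' t) - I * (p t - p' t) with hh
  have hgm : AEStronglyMeasurable g ν := (hqm.add hpm).aestronglyMeasurable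
  have hhm : AEStronglyMeasurable h ν := (hqm.sub hpm).aestronglyMeasurable
  set e : ℝ → ℂ := fun t => (1 / 2) * (g t - h (Real.pi + a - t)) with he
  have hhr : AEStronglyMeasurable (fun t => h (Real.pi + a - t)) ν :=
    hhm.comp_measurePreserving (measurePreserving_reflection a)
  have hem : AEStronglyMeasurable e ν := (hgm.sub hhr).const_mul _
  have hd0m : AEStronglyMeasurable d0 ν :=
    ((memLp_density ha hq hp 0).sub (memLp_density ha hq' hp' 0)).aestronglyMeasurable
  have hd0e : ∀ t, d0 t = (1 / 2) * (g t + h (Real.pi + a - t)) := by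
    intro t
    simp only [hd0, density_zero, hg, hh]
    ring
  have hed1 : eLpNorm e 2 ν = eLpNorm d1 2 ν := by
    refine eLpNorm_congr_norm_ae (Eventually.of_forall fun t => ?_)
    have h1 : d1 t = I * (e t * exp (((-(1 / 2) * (Real.pi + a - 2 * t) : ℝ) : ℂ) * I)) := by
      have h2 : ((-(1 / 2) * (Real.pi + a - 2 * t) : ℝ) : ℂ) * I =
          I * (-1 / 2) * (Real.pi + a - 2 * t) := by
        push_cast
        ring
      rw [h2]
      simp only [hd1, density_one, he, hg, hh]
      ring
    rw [h1, norm_mul I, norm_mul (e t), norm_exp_ofReal_mul_I, norm_I, one_mul, mul_one]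
  have hgn : eLpNorm g 2 ν ≤ eLpNorm d0 2 ν + eLpNorm d1 2 ν := by
    rw [← hed1]
    refine le_trans (le_of_eq ?_) (eLpNorm_add_le hd0m hem one_le_two)
    congr 1
    funext t
    rw [Pi.add_apply, hd0e, he]
    ring
  have hhn : eLpNorm h 2 ν ≤ eLpNorm d0 2 ν + eLpNorm d1 2 ν := by
    rw [← hed1, ← eLpNorm_reflection hhm]
    refine le_trans (le_of_eq ?_) (eLpNorm_sub_le hd0m hem one_le_two)
    congr 1
    funext t
    rw [Pi.sub_apply, hd0e, he]
    ring
  obtain ⟨hqn, hpn⟩ := eLpNorm_le_add_of_gauge (u := fun x => q x - q' x)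
    (v := fun x => p x - p' x) hgm hhm (fun _ => rfl) (fun _ => rfl)
  calc _ ≤ (eLpNorm g 2 ν + eLpNorm h 2 ν) + (eLpNorm g 2 ν + eLpNorm h 2 ν) :=
        add_le_add hqn hpn
    _ ≤ ((eLpNorm d0 2 ν + eLpNorm d1 2 ν) + (eLpNorm d0 2 ν + eLpNorm d1 2 ν)) +
        ((eLpNorm d0 2 ν + eLpNorm d1 2 ν) + (eLpNorm d0 2 ν + eLpNorm d1 2 ν)) := by gcongr
    _ = _ := by ring

end DiracDelay

theorem theorem6 (r : ℝ) (hr : 0 < r) :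
    ∃ C : ℝ, 0 < C ∧
      ∀ (a : ℝ), Real.pi / 2 ≤ a → a < Real.pi →
      ∀ (q p q' p' : ℝ → ℂ),
        DiracDelay.IsAdmissible a q → DiracDelay.IsAdmissible a p →
        DiracDelay.IsAdmissible a q' → DiracDelay.IsAdmissible a p' →
      ∀ (lam lam' : Fin 2 → ℤ → ℂ),
        (∀ j, DiracDelay.IsSpectrum a (DiracDelay.potential q p) j (lam j)) →
        (∀ j, DiracDelay.IsSpectrum a (DiracDelay.potential q' p') j (lam' j)) →
        (∀ j, DiracDelay.l2Norm (fun n => lam j n - ((n : ℂ) - (j.val : ℂ) / 2)) ≤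
          ENNReal.ofReal r) →
        (∀ j, DiracDelay.l2Norm (fun n => lam' j n - ((n : ℂ) - (j.val : ℂ) / 2)) ≤
          ENNReal.ofReal r) →
        DiracDelay.L2Norm a (fun x => q x - q' x) + DiracDelay.L2Norm a (fun x => p x - p' x) ≤
          ENNReal.ofReal C *
            (DiracDelay.l2Norm (fun n => lam 0 n - lam' 0 n) +
              DiracDelay.l2Norm (fun n => lam 1 n - lam' 1 n)) := by
  obtain ⟨C, hC, hmain⟩ := DiracDelay.exists_density_stability r hr
  refine ⟨4 * C, by positivity, ?_⟩
  intro a ha ha' q p q' p' hq hp hq' hp' lam lam' hlam hlam' hr1 hr2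
  have h0 := hmain a ha ha' _ _ (DiracDelay.memLp_density ha hq hp 0)
    (DiracDelay.memLp_density ha hq' hp' 0) (lam 0) (lam' 0)
    ((hlam 0).card_le_zero ha ha' hq hp) ((hlam' 0).card_le_zero ha ha' hq' hp')
    (by simpa using hr1 0) (by simpa using hr2 0)
  -- The second spectrum is close to `n - 1/2`; translating it by `1/2` makes it comparable with the
  -- zeros of `sin πz` and leaves the differences of eigenvalues unchanged.
  have hshift : ∀ l : ℤ → ℂ, (fun n : ℤ => l n + 1 / 2 - n) =
      fun n : ℤ => l n - ((n : ℂ) - (((1 : Fin 2).val : ℕ) : ℂ) / 2) := by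
    intro l
    funext n
    rw [Fin.val_one, Nat.cast_one]
    ring
  have h1 := hmain a ha ha' _ _ (DiracDelay.memLp_density ha hq hp 1)
    (DiracDelay.memLp_density ha hq' hp' 1) (fun n => lam 1 n + 1 / 2) (fun n => lam' 1 n + 1 / 2)
    ((hlam 1).card_le_one ha ha' hq hp) ((hlam' 1).card_le_one ha ha' hq' hp')
    (by rw [hshift]; exact hr1 1) (by rw [hshift]; exact hr2 1)
  simp only [add_sub_add_right_eq_sub] at h1
  refine (DiracDelay.eLpNorm_sub_le_density ha hq hp hq' hp').trans ?_
  rw [ENNReal.ofReal_mul (by norm_num), ENNReal.ofReal_ofNat, mul_assoc, mul_add (ENNReal.ofReal C)]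
  gcongr
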